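/- Consider the following randomized algorithm $\mathrm{Select}(X,k)$, which finds the $k$th smallest of $n=|X|$ elements ($1\le k\le n$) of a totally ordered set, where the elements need not be distinct; a comparison of two elements $x,y$ has three possible outcomes, $x<y$, $x=y$, $x>y$. If $n=1$, return the only element. Otherwise, for a sample size $s=s(n)\le n-1$ and a gap $g=g(n)>0$, draw a uniformly random $s$-element sample $S\subset X$ without replacement and set $i_u=\max\{\lceil ks/n-g\rceil,1\}$, $i_v=\min\{\lceil ks/n+g\rceil,s\}$. Find the $i_u$th smallest element $u$ of $S$ by calling Select recursively on $S$; if $i_u<i_v$, remove the $i_u$ smallest elements from $S$ and find the $i_v$th smallest element $v$ of $S$ by calling Select recursively on the remaining part of $S$ with rank $i_v-i_u$; otherwise $v=u$. (Select also reports which elements are less than, equal to, or greater than the element found, so the positions of the elements of $S$ relative to $u$ and $v$ are known.) Compare each $x\in X\setminus S$ to the pivots: if $k<n/2$, to $v$ first and to $u$ only if $x<v$ and $u<v$; if $k\ge n/2$, to $u$ first and to $v$ only if $u<x$ and $u<v$. This gives $L=\{x<u\}$, $U=\{x=u\}$, $M=\{u<x<v\}$, $V=\{x=v\}$, $R=\{x>v\}$.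 If $|L|<k\le|L\cup U|$, return $u$; else if $|L\cup U\cup M|<k\le n-|R|$, return $v$; else return $\mathrm{Select}(L,k)$ if $k\le|L|$, $\mathrm{Select}(R,k-n+|R|)$ if $n-|R|<k$, and $\mathrm{Select}(M,k-|L\cup U|)$ otherwise. Let $\alpha,\beta>0$ and $0<\epsilon<\epsilon_s$ be fixed with $$\eta:=\max\{1+(\epsilon-\epsilon_s)/2,\ \epsilon_s\}<1,$$ and let $$s(n)=\min\{\lceil\alpha n^{\epsilon_s}\rceil,\,n-1\},\qquad g(n)=\bigl(\beta\,s(n)\,n^{\epsilon}\bigr)^{1/2}.$$ Then there exists a constant $\gamma_\eta>0$, depending only on $\alpha,\beta,\epsilon,\epsilon_s$, such that for all $1\le k\le n$ and every input $X$ of $n$ (not necessarily distinct) elements, the expected number of comparisons made by $\mathrm{Select}(X,k)$ is at most $$n+\min\{k,n-k\}+\gamma_\eta\,n^{\eta}.$$ -/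

import Mathlib

/-- Randomized comparison programs on elements that are known only by their names `i : ι`:
the program never sees the keys, and learns about them only through three-way comparisons.
* `ret b` returns `b`;
* `cmp i j next` compares the keys of `i` and `j` and continues according to the outcome;
* `sample X s next` draws a uniformly random `s`-element subset of `X` (without replacement);
* `diverge` is a run that does not produce a result; it is charged infinitely many comparisons. -/
inductive Prog (ι β : Type) : Type where
  | ret (b : β) : Prog ι β
  | cmp (i j : ι) (next : Ordering → Prog ι β) : Prog ι β
  | sample (X : Finset ι) (s : ℕ) (next : Finset ι → Prog ι β) : Prog ι β
  | diverge : Prog ι β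

namespace Prog

/-- Sequential composition of programs. -/
def bind {ι β δ : Type} : Prog ι β → (β → Prog ι δ) → Prog ι δ
  | ret b, f => f b
  | cmp i j next, f => cmp i j fun o => (next o).bind f
  | sample X s next, f => sample X s fun S => (next S).bind f
  | diverge, _ => diverge

instance {ι : Type} : Monad (Prog ι) where
  pure := ret
  bind := bind

/-- The law of the number of comparisons made by a program when element `i` has key `x i`.
(Drawing more elements than there are is impossible, and treated as divergence.) -/
noncomputable def comparisons {ι β : Type} {κ : Type*} [LinearOrder κ] (x : ι → κ) :
    Prog ι β → PMF ℕ∞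
  | ret _ => PMF.pure 0
  | cmp i j next => (comparisons x (next (compare (x i) (x j)))).map (fun c => 1 + c)
  | sample X s next =>
      if h : (X.powersetCard s).Nonempty then
        (PMF.uniformOfFinset (X.powersetCard s) h).bind fun S => comparisons x (next S)
      else PMF.pure ⊤
  | diverge => PMF.pure ⊤

/-- The expected number of comparisons made by a program on the keys `x`. -/
noncomputable def expectedComparisons {ι β : Type} {κ : Type*} [LinearOrder κ] (x : ι → κ)
    (p : Prog ι β) : ENNReal :=
  ∑' c : ℕ∞, comparisons x p c * (c : ENNReal)

/-- One comparison, returning its outcome. -/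
def compareKeys {ι : Type} (i j : ι) : Prog ι Ordering := cmp i j ret

/-- One random sample of `s` elements of `X`. -/
def drawSample {ι : Type} (X : Finset ι) (s : ℕ) : Prog ι (Finset ι) := sample X s ret

/-- Some element of `A`. -/
noncomputable def pick {ι : Type} (A : Finset ι) : Prog ι ι :=
  match A.toList with
  | [] => diverge
  | i :: _ => ret i

end Prog

/-- What `Select` returns for the input set `X` and the rank `k`: the set `eq` of the elements of
`X` that are equal to the `k`th smallest one, and the set `lt` of those that are less than it.
The other elements of `X` are greater. -/
structure Split (ι : Type) where
  lt : Finset ι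
  eq : Finset ι

/-- The five blocks of the partition: `x < u`, `x = u`, `u < x < v`, `x = v`, `v < x`
(when `u = v`, the elements equal to both are put into block `U`). -/
inductive Block where
  | L | U | M | V | R
  deriving DecidableEq

namespace Select

open Prog

variable {ι : Type} [DecidableEq ι]

/-- The pivot ranks in a sample of size `s` (the natural-number ceiling is `0` at negative
numbers, which the maximum with `1` absorbs). -/
noncomputable def rankU (n k s : ℕ) (g : ℝ) : ℕ := max ⌈(k : ℝ) * s / n - g⌉₊ 1

noncomputable def rankV (n k s : ℕ) (g : ℝ) : ℕ := min ⌈(k : ℝ) * s / n + g⌉₊ s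

/-- The `i` smallest elements of a set whose split about its `i`th smallest element is `a`. -/
noncomputable def smallest (a : Split ι) (i : ℕ) : Finset ι :=
  a.lt ∪ (a.eq.toList.take (i - a.lt.card)).toFinset

/-- The block of a sample element, read off (without comparisons) from the splits of the sample
about `u` and of its remaining part about `v`. -/
def sampleBlock (a b : Split ι) (y : ι) : Block :=
  if y ∈ a.lt then .L else if y ∈ a.eq then .U else
  if y ∈ b.lt then .M else if y ∈ b.eq then .V else .R

/-- Find the block of `y` by comparing it to the pivots. If `vFirst`, then `y` is compared to `v`
first, and to `u` only if `y < v` and `u < v`; otherwise `y` is compared to `u` first, and to `v`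
only if `u < y` and `u < v`. The flag `same` tells whether `u = v`. -/
def classify (vFirst same : Bool) (u v y : ι) : Prog ι Block :=
  if vFirst then do
    match ← compareKeys y v with
    | .gt => return .R
    | .eq => return if same then .U else .V
    | .lt =>
      if same then return .L
      else
        match ← compareKeys y u with
        | .lt => return .L
        | .eq => return .U
        | .gt => return .M
  else do
    match ← compareKeys y u with
    | .lt => return .L
    | .eq => return .U
    | .gt =>
      if same then return .R
      else
        match ← compareKeys y v with
        | .lt => return .M
        | .eq => return .V
        | .gt => return .R

/-- Classify the listed elements one after the other, recording the blocks in `ρ`. -/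
def partition (vFirst same : Bool) (u v : ι) : List ι → (ι → Block) → Prog ι (ι → Block)
  | [], ρ => return ρ
  | y :: ys, ρ => do
    let r ← classify vFirst same u v y
    partition vFirst same u v ys (Function.update ρ y r)

/-- Stopping test, reduction and final recursive call, for the partition `ρ` of `X`. -/
def finish (recur : Finset ι → ℕ → Prog ι (Split ι)) (X : Finset ι) (k : ℕ) (ρ : ι → Block) :
    Prog ι (Split ι) :=
  let L := X.filter fun y => ρ y = .L
  let U := X.filter fun y => ρ y = .U
  let M := X.filter fun y => ρ y = .M
  let V := X.filter fun y => ρ y = .V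
  let R := X.filter fun y => ρ y = .R
  if L.card < k ∧ k ≤ (L ∪ U).card then return ⟨L, U⟩
  else if (L ∪ U ∪ M).card < k ∧ k ≤ X.card - R.card then return ⟨L ∪ U ∪ M, V⟩
  else if k ≤ L.card then recur L k
  else if X.card - R.card < k then do
    let c ← recur R (k - (X.card - R.card))
    return ⟨(X \ R) ∪ c.lt, c.eq⟩
  else do
    let c ← recur M (k - (L ∪ U).card)
    return ⟨(L ∪ U) ∪ c.lt, c.eq⟩

/-- The body of `Select` for the sample size `s` and the gap `g` (functions of the size of the
current set), with `recur` in place of the recursive calls. The pivot `u` is found in the sample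
`S`, and `v` in what remains of `S` without its `i_u` smallest elements; then only the
elements of `X` outside `S` are compared to the pivots. -/
noncomputable def body (s : ℕ → ℕ) (g : ℕ → ℝ) (recur : Finset ι → ℕ → Prog ι (Split ι))
    (X : Finset ι) (k : ℕ) : Prog ι (Split ι) :=
  let n := X.card
  if n = 1 then return ⟨∅, X⟩
  else do
    let S ← drawSample X (s n)
    let iu := rankU n k (s n) (g n)
    let iv := rankV n k (s n) (g n)
    let a ← recur S iu
    let b ← (if iu < iv then recur (S \ smallest a iu) (iv - iu) else pure a)
    let u ← pick a.eq
    let v ← pick b.eq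
    let ρ ← partition (2 * k < n) (v ∈ a.eq) u v (X \ S).toList (sampleBlock a b)
    finish recur X k ρ

/-- `Select` with recursion depth at most `d`; exceeding the depth counts as divergence. -/
noncomputable def upToDepth (s : ℕ → ℕ) (g : ℕ → ℝ) : ℕ → Finset ι → ℕ → Prog ι (Split ι)
  | 0, _, _ => diverge
  | d + 1, X, k => body s g (upToDepth s g d) X k

end Select

/-- The algorithm `Select` for the `k`th smallest element of `X`. The recursive calls are on
strictly smaller nonempty sets, so that the recursion is never deeper than `|X|`. -/
noncomputable def select {ι : Type} [DecidableEq ι] (s : ℕ → ℕ) (g : ℕ → ℝ) (X : Finset ι)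
    (k : ℕ) : Prog ι (Split ι) :=
  Select.upToDepth s g X.card X k

/-- The sample size `min {⌈α n ^ εs⌉, n - 1}`. -/
noncomputable def reischukSize (α εs : ℝ) (n : ℕ) : ℕ := min ⌈α * (n : ℝ) ^ εs⌉₊ (n - 1)

/-- The gap `(β s n ^ ε) ^ (1 / 2)`. -/
noncomputable def reischukGap (α β ε εs : ℝ) (n : ℕ) : ℝ :=
  Real.sqrt (β * (reischukSize α εs n : ℝ) * (n : ℝ) ^ ε)

/-!
The cost of a program is measured by its expected runtime transformer `Prog.ert`, which adds a
payoff for the result to the number of comparisons and is therefore compositional. The triples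
`Prog.HasCost x p P c` derived from it say that every result of `p` satisfies `P` and that the
expected number of comparisons is at most `c`, so that the correctness of `Select`, on which the
sizes of its recursive calls depend, and its cost are proved together.

In a round on a set of `n` elements with sample size `s` and gap `g`, put `t = n * g / s`. For a
set `A` of `m` smallest elements, the number of sampled elements of `A` is hypergeometric with mean
`m * s / n`; its generating function is dominated by the binomial one, so a deviation by `g` has
probability at most `δ = exp (-g ^ 2 / (4 * s))`. Applying this to four values of `m` near
`k ± 2 * t`, `k`, and the ends of the range shows that, outside an event of probability `4 * δ`,
all but `min k (n - k) + 2 * t` elements are compared to one pivot only, and the residual call is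
on at most `4 * t` elements (`Select.exists_bad_samples`). If the extreme order statistics of the
sample have to serve as pivots, the residual call may be on `L` or `R`, but then it is on at most
`t` elements.

Hence the expected cost is at most `n + min k (n - k)`, plus an overhead linear in `s`, `t` and
`δ * n`, plus the error terms `γ * m ^ η` of the recursive calls with `m = s` (twice), `m = 4 * t`,
and, with weight `4 * δ`, `m = n` (`Select.body_hasCost_average`). For the given `s` and `g`, both
`s` and `t` are `O(n ^ η)` and `δ = exp (-β * n ^ ε / 4)`. The overhead is thus `O(n ^ η)`, and
since `η < 1`, the recursive error terms are `γ * O(n ^ (η * η)) + 4 * δ * γ * n ^ η`, at most half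
of `γ * n ^ η` for large `n`. Small `n` are covered by the worst-case bound `4 ^ (n + 1)`.
-/

open scoped ENNReal

/-! ### Expected runtimes of comparison programs -/

namespace Prog

section Runtime

variable {ι β δ : Type} {κ : Type*} [LinearOrder κ] (x : ι → κ)

/-- The expected value of the number of comparisons made by a program plus `f b`, where `b` is
the result of the program (the expected runtime transformer of the program). Unlike
`expectedComparisons`, it is compositional: see `ert_bind`. -/
noncomputable def ert : Prog ι β → (β → ℝ≥0∞) → ℝ≥0∞
  | ret b, f => f b
  | cmp i j next, f => 1 + ert (next (compare (x i) (x j))) f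
  | sample X s next, f =>
      if (X.powersetCard s).Nonempty then
        (∑ S ∈ X.powersetCard s, ert (next S) f) / (X.powersetCard s).card
      else ⊤
  | diverge, _ => ⊤

theorem ert_bind (p : Prog ι β) (q : β → Prog ι δ) (f : δ → ℝ≥0∞) :
    ert x (p.bind q) f = ert x p fun b => ert x (q b) f := by
  induction p with
  | ret b => rfl
  | cmp i j next ih => simp only [Prog.bind, ert, ih]
  | sample X s next ih => simp only [Prog.bind, ert, ih]
  | diverge => rfl

theorem tsum_pmf_bind_mul {σ τ : Type*} (p : PMF σ) (q : σ → PMF τ) (F : τ → ℝ≥0∞) :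
    ∑' b, p.bind q b * F b = ∑' a, p a * ∑' b, q a b * F b := by
  simp only [PMF.bind_apply, ← ENNReal.tsum_mul_right, ← ENNReal.tsum_mul_left, mul_assoc]
  exact ENNReal.tsum_comm

theorem tsum_pmf_pure_mul {σ : Type*} (a : σ) (F : σ → ℝ≥0∞) :
    ∑' b, PMF.pure a b * F b = F a := by
  classical
  rw [tsum_eq_single a]
  · simp
  · intro b hb
    simp [hb]

theorem expectedComparisons_eq_ert (p : Prog ι β) : expectedComparisons x p = ert x p 0 := by
  unfold expectedComparisons
  induction p with
  | ret b => simp [comparisons, ert]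
  | cmp i j next ih =>
    rw [comparisons, ert, ← ih, ← PMF.bind_pure_comp, tsum_pmf_bind_mul]
    simp only [Function.comp_apply, tsum_pmf_pure_mul]
    have h : ∀ c : ℕ∞, ((1 + c : ℕ∞) : ℝ≥0∞) = 1 + (c : ℝ≥0∞) := fun c => by simp
    simp only [h, mul_add, mul_one, ENNReal.tsum_add, PMF.tsum_coe]
  | sample X s next ih =>
    rw [comparisons, ert]
    split_ifs with h
    · rw [tsum_pmf_bind_mul, tsum_eq_sum (s := X.powersetCard s)]
      · rw [div_eq_mul_inv, mul_comm, Finset.mul_sum]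
        refine Finset.sum_congr rfl fun S hS => ?_
        rw [ih, PMF.uniformOfFinset_apply_of_mem _ hS]
      · intro S hS
        rw [PMF.uniformOfFinset_apply_of_notMem _ hS, zero_mul]
    · simp
  | diverge => simp [comparisons, ert]

/-- Every run of `p` ends in a result satisfying `P`, and the expected number of comparisons is at
most `c`. Both are expressed at once by letting the final payoff `f` vary: `f` may be `⊤` outside
`P`. -/
def HasCost (p : Prog ι β) (P : β → Prop) (c : ℝ≥0∞) : Prop :=
  ∀ (f : β → ℝ≥0∞) (r : ℝ≥0∞), (∀ b, P b → f b ≤ r) → ert x p f ≤ c + r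

variable {x} {P : β → Prop} {Q : δ → Prop} {c c' : ℝ≥0∞}

theorem HasCost.expectedComparisons_le {p : Prog ι β} (h : HasCost x p P c) :
    expectedComparisons x p ≤ c := by
  rw [expectedComparisons_eq_ert]
  simpa using h 0 0 fun _ _ => le_rfl

theorem HasCost.mono {p : Prog ι β} (h : HasCost x p P c) (hc : c ≤ c') : HasCost x p P c' :=
  fun f r hf => (h f r hf).trans (by gcongr)

theorem HasCost.imp {P' : β → Prop} {p : Prog ι β} (h : HasCost x p P c)
    (hP : ∀ b, P b → P' b) : HasCost x p P' c :=
  fun f r hf => h f r fun b hb => hf b (hP b hb)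

theorem hasCost_ret {b : β} (hb : P b) : HasCost x (ret b) P 0 := fun f r hf => by
  simpa [ert] using hf b hb

theorem hasCost_pure {b : β} (hb : P b) : HasCost x (pure b : Prog ι β) P 0 := hasCost_ret hb

theorem HasCost.bind {p : Prog ι β} {q : β → Prog ι δ} (hp : HasCost x p P c)
    (hq : ∀ b, P b → HasCost x (q b) Q c') : HasCost x (p >>= q) Q (c + c') := fun f r hf => by
  change ert x (p.bind q) f ≤ _
  rw [ert_bind, add_assoc]
  exact hp _ _ fun b hb => hq b hb f r hf

theorem hasCost_compareKeys (i j : ι) :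
    HasCost x (compareKeys i j) (fun o => o = compare (x i) (x j)) 1 := fun f r hf => by
  simpa [compareKeys, ert] using hf _ rfl

/-- The cost of a continuation after a random draw is averaged over the possible samples. -/
theorem hasCost_drawSample_bind {X : Finset ι} {s : ℕ} (hs : s ≤ X.card)
    {q : Finset ι → Prog ι β} {K : Finset ι → ℝ≥0∞}
    (hq : ∀ S ∈ X.powersetCard s, HasCost x (q S) P (K S)) :
    HasCost x (drawSample X s >>= q) P
      ((∑ S ∈ X.powersetCard s, K S) / (X.powersetCard s).card) := fun f r hf => by
  change ert x (sample X s q) f ≤ _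
  have hne : (X.powersetCard s).Nonempty := Finset.powersetCard_nonempty.2 hs
  have hcard : ((X.powersetCard s).card : ℝ≥0∞) ≠ 0 := by
    exact_mod_cast hne.card_pos.ne'
  rw [ert, if_pos hne]
  calc _ ≤ (∑ S ∈ X.powersetCard s, (K S + r)) / (X.powersetCard s).card := by
        gcongr with S hS
        exact hq S hS f r hf
    _ = _ := by
        rw [Finset.sum_add_distrib, Finset.sum_const, nsmul_eq_mul, ENNReal.add_div,
          mul_div_assoc, mul_comm, ENNReal.div_mul_cancel hcard (ENNReal.natCast_ne_top _)]

theorem hasCost_pick {A : Finset ι} (hA : A.Nonempty) : HasCost x (pick A) (· ∈ A) 0 := by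
  unfold pick
  have h : ∀ i, i ∈ A.toList → i ∈ A := fun i => Finset.mem_toList.1
  have h' : A.toList ≠ [] := by simpa using hA.ne_empty
  split
  · contradiction
  · next i l hl => exact hasCost_ret (h i (by simp [hl]))

end Runtime

end Prog

/-! ### Correctness and cost of one round of `Select` -/

namespace Select

open Prog

variable {ι : Type} [DecidableEq ι] {κ : Type*} [LinearOrder κ] {x : ι → κ}

/-- The key `z` is the `i`th smallest key of `S`, counted with multiplicity. -/
def IsRank (x : ι → κ) (S : Finset ι) (i : ℕ) (z : κ) : Prop :=
  {y ∈ S | x y < z}.card < i ∧ i ≤ {y ∈ S | x y ≤ z}.card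

/-- `a` is a correct answer of `Select` on `X` and `k`. -/
def IsSplit (x : ι → κ) (X : Finset ι) (k : ℕ) (a : Split ι) : Prop :=
  ∃ z, IsRank x X k z ∧ a.lt = {y ∈ X | x y < z} ∧ a.eq = {y ∈ X | x y = z}

omit [DecidableEq ι] in
theorem IsRank.exists_eq {S : Finset ι} {i : ℕ} {z : κ} (h : IsRank x S i z) :
    ∃ y ∈ S, x y = z := by
  by_contra! hne
  have : {y ∈ S | x y ≤ z} = {y ∈ S | x y < z} :=
    Finset.filter_congr fun y hy => ⟨fun hle => lt_of_le_of_ne hle (hne y hy), le_of_lt⟩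
  have h1 := h.1
  have h2 := h.2
  rw [this] at h2
  omega

/-- A correct answer on a block `B` of consecutive keys of `X` yields one on `X`, where `D` holds
the elements below the block. -/
theorem IsSplit.of_block {X D B : Finset ι} {k : ℕ} {a : Split ι} (hD : D ⊆ X) (hB : B ⊆ X)
    (hDB : ∀ d ∈ D, ∀ b ∈ B, x d < x b) (hgt : ∀ y ∈ X, y ∉ D → y ∉ B → ∀ b ∈ B, x b < x y)
    (hk : D.card < k) (ha : IsSplit x B (k - D.card) a) :
    IsSplit x X k ⟨D ∪ a.lt, a.eq⟩ := by
  obtain ⟨z, hz, hlt, heq⟩ := ha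
  obtain ⟨b, hb, rfl⟩ := hz.exists_eq
  have hdisj : Disjoint D B := Finset.disjoint_left.2 fun d hd hd' => (hDB d hd d hd').false
  have h1 : {y ∈ X | x y < x b} = D ∪ {y ∈ B | x y < x b} := by
    ext y
    simp only [Finset.mem_filter, Finset.mem_union]
    constructor
    · rintro ⟨hy, hyb⟩
      by_cases hyD : y ∈ D
      · exact Or.inl hyD
      · by_cases hyB : y ∈ B
        · exact Or.inr ⟨hyB, hyb⟩
        · exact absurd hyb (hgt y hy hyD hyB b hb).not_gt
    · rintro (hy | ⟨hy, hyb⟩)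
      · exact ⟨hD hy, hDB y hy b hb⟩
      · exact ⟨hB hy, hyb⟩
  have h2 : {y ∈ X | x y = x b} = {y ∈ B | x y = x b} := by
    ext y
    simp only [Finset.mem_filter]
    constructor
    · rintro ⟨hy, hyb⟩
      refine ⟨?_, hyb⟩
      by_contra hyB
      by_cases hyD : y ∈ D
      · exact (hDB y hyD b hb).ne hyb
      · exact (hgt y hy hyD hyB b hb).ne' hyb
    · rintro ⟨hy, hyb⟩
      exact ⟨hB hy, hyb⟩
  have h3 : {y ∈ X | x y ≤ x b} = D ∪ {y ∈ B | x y ≤ x b} := by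
    simp only [le_iff_lt_or_eq, Finset.filter_or, h1, h2, Finset.union_assoc]
  have h4 : Disjoint D {y ∈ B | x y < x b} := hdisj.mono_right (Finset.filter_subset _ _)
  have h5 : Disjoint D {y ∈ B | x y ≤ x b} := hdisj.mono_right (Finset.filter_subset _ _)
  refine ⟨x b, ⟨?_, ?_⟩, by rw [h1, hlt], by rw [h2, heq]⟩
  · rw [h1, Finset.card_union_of_disjoint h4]
    have := hz.1
    omega
  · rw [h3, Finset.card_union_of_disjoint h5]
    have := hz.2
    omega

/-- The block of a key `w` with respect to pivot keys `zu ≤ zv`. -/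
def keyBlock (zu zv w : κ) : Block :=
  if w < zu then .L else if w = zu then .U else if w < zv then .M else if w = zv then .V else .R

/-- An element with key `w` is compared to both pivots, whose keys are `zu` and `zv`. -/
def NeedsBoth (vFirst : Bool) (zu zv w : κ) : Prop :=
  zu < zv ∧ if vFirst then w < zv else zu < w

instance (vFirst : Bool) (zu zv w : κ) : Decidable (NeedsBoth vFirst zu zv w) := by
  unfold NeedsBoth
  infer_instance

omit [DecidableEq ι] in
theorem classify_hasCost (vFirst : Bool) {u v : ι} (huv : x u ≤ x v) (y : ι) :
    HasCost x (classify vFirst (decide (x u = x v)) u v y)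
      (· = keyBlock (x u) (x v) (x y))
      (1 + if NeedsBoth vFirst (x u) (x v) (x y) then 1 else 0) := by
  have ert_cmp : ∀ (i j : ι) (q : Ordering → Prog ι Block) (f : Block → ℝ≥0∞),
      ert x (compareKeys i j >>= q) f = 1 + ert x (q (compare (x i) (x j))) f :=
    fun _ _ _ _ => rfl
  have ert_pure : ∀ (b : Block) (f : Block → ℝ≥0∞), ert x (pure b) f = f b := fun _ _ => rfl
  intro f r hf
  have hf' := hf _ rfl
  have key : ∀ i j : ι, (compare (x i) (x j) = .lt ∧ x i < x j) ∨
      (compare (x i) (x j) = .eq ∧ x i = x j) ∨ (compare (x i) (x j) = .gt ∧ x j < x i) := by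
    intro i j
    rcases lt_trichotomy (x i) (x j) with h | h | h
    · exact Or.inl ⟨compare_lt_iff_lt.2 h, h⟩
    · exact Or.inr (Or.inl ⟨compare_eq_iff_eq.2 h, h⟩)
    · exact Or.inr (Or.inr ⟨compare_gt_iff_gt.2 h, h⟩)
  unfold keyBlock at hf'
  rcases huv.eq_or_lt with h | h
  · cases vFirst
    · rcases key y u with ⟨h1, h1'⟩ | ⟨h1, h1'⟩ | ⟨h1, h1'⟩ <;>
        simp_all [classify, NeedsBoth, lt_asymm, ne_of_gt]
    · rcases key y v with ⟨h1, h1'⟩ | ⟨h1, h1'⟩ | ⟨h1, h1'⟩ <;>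
        simp_all [classify, NeedsBoth, lt_asymm, ne_of_gt]
  · have hne := h.ne
    cases vFirst
    · rcases key y u with ⟨h1, h1'⟩ | ⟨h1, h1'⟩ | ⟨h1, h1'⟩
      · simp_all [classify, NeedsBoth, lt_asymm]
      · simp_all [classify, NeedsBoth]
      · rcases key y v with ⟨h2, h2'⟩ | ⟨h2, h2'⟩ | ⟨h2, h2'⟩ <;>
          simp_all [classify, NeedsBoth, lt_asymm, ne_of_gt, add_assoc]
    · rcases key y v with ⟨h1, h1'⟩ | ⟨h1, h1'⟩ | ⟨h1, h1'⟩
      · rcases key y u with ⟨h2, h2'⟩ | ⟨h2, h2'⟩ | ⟨h2, h2'⟩ <;>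
          simp_all [classify, NeedsBoth, lt_asymm, ne_of_gt, add_assoc]
      · simp_all [classify, NeedsBoth, lt_asymm, ne_of_gt]
      · have := h.trans h1'
        simp_all [classify, NeedsBoth, lt_asymm, ne_of_gt]

theorem partition_hasCost (vFirst : Bool) {u v : ι} (huv : x u ≤ x v) (l : List ι)
    (ρ : ι → Block) :
    HasCost x (partition vFirst (decide (x u = x v)) u v l ρ)
      (fun ρ' => ∀ y, ρ' y = if y ∈ l then keyBlock (x u) (x v) (x y) else ρ y)
      (l.length + (l.countP fun y => NeedsBoth vFirst (x u) (x v) (x y) : ℕ)) := by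
  induction l generalizing ρ with
  | nil => exact (hasCost_pure (by simp)).mono zero_le
  | cons y l ih =>
    refine ((classify_hasCost vFirst huv y).bind (c' := _) fun b hb =>
      (ih (Function.update ρ y b)).imp fun ρ' hρ' w => ?_).mono (le_of_eq ?_)
    · rw [hρ', hb]
      by_cases hw : w ∈ l
      · simp [hw]
      · by_cases hwy : w = y
        · simp [hwy]
        · simp [hw, hwy]
    · rw [List.countP_cons, List.length_cons]
      split_ifs <;> simp_all <;> ring

/-- The cost of the final recursive call in terms of the pivot keys, when recursive calls on sets
of size `m` cost `c m`. -/
noncomputable def residualCost (c : ℕ → ℝ≥0∞) (x : ι → κ) (X : Finset ι) (k : ℕ) (zu zv : κ) :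
    ℝ≥0∞ :=
  if k ≤ {y ∈ X | x y < zu}.card then c {y ∈ X | x y < zu}.card
  else if {y ∈ X | x y ≤ zv}.card < k then c {y ∈ X | zv < x y}.card
  else if {y ∈ X | x y ≤ zu}.card < k ∧ k ≤ {y ∈ X | x y < zv}.card then
    c {y ∈ X | zu < x y ∧ x y < zv}.card
  else 0

theorem finish_hasCost {recur : Finset ι → ℕ → Prog ι (Split ι)} {c : ℕ → ℝ≥0∞}
    {X : Finset ι} {k : ℕ} {ρ : ι → Block} {zu zv : κ} (hk1 : 1 ≤ k) (hkX : k ≤ X.card)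
    (huv : zu ≤ zv) (hu : ∃ u ∈ X, x u = zu) (hv : ∃ v ∈ X, x v = zv)
    (hρ : ∀ y ∈ X, ρ y = keyBlock zu zv (x y))
    (hrec : ∀ Y j, 1 ≤ j → j ≤ Y.card → Y.card < X.card →
      HasCost x (recur Y j) (IsSplit x Y j) (c Y.card)) :
    HasCost x (finish recur X k ρ) (IsSplit x X k) (residualCost c x X k zu zv) := by
  have hL : {y ∈ X | ρ y = .L} = {y ∈ X | x y < zu} := Finset.filter_congr fun y hy => by
    rw [hρ y hy]; unfold keyBlock; split_ifs <;> simp_all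
  have hU : {y ∈ X | ρ y = .U} = {y ∈ X | x y = zu} := Finset.filter_congr fun y hy => by
    rw [hρ y hy]; unfold keyBlock; split_ifs <;> simp_all [ne_of_lt]
  have hM : {y ∈ X | ρ y = .M} = {y ∈ X | zu < x y ∧ x y < zv} :=
    Finset.filter_congr fun y hy => by
      rw [hρ y hy]; unfold keyBlock; split_ifs <;> grind
  have hV : {y ∈ X | ρ y = .V} = {y ∈ X | zu < x y ∧ x y = zv} :=
    Finset.filter_congr fun y hy => by
      rw [hρ y hy]; unfold keyBlock; split_ifs <;> grind
  have hR : {y ∈ X | ρ y = .R} = {y ∈ X | zv < x y} := Finset.filter_congr fun y hy => by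
    rw [hρ y hy]; unfold keyBlock; split_ifs <;> grind
  have hLU : {y ∈ X | x y < zu} ∪ {y ∈ X | x y = zu} = {y ∈ X | x y ≤ zu} := by
    simp only [le_iff_lt_or_eq, Finset.filter_or]
  have hRc : X.card - {y ∈ X | zv < x y}.card = {y ∈ X | x y ≤ zv}.card := by
    have := Finset.card_filter_add_card_filter_not (s := X) (fun y => zv < x y)
    simp only [not_lt] at this
    omega
  have hXR : X \ {y ∈ X | zv < x y} = {y ∈ X | x y ≤ zv} := by
    ext y; simp; grind
  have hlt : ∀ p : ι → Prop, ∀ [DecidablePred p], (∃ y ∈ X, ¬ p y) →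
      (X.filter p).card < X.card := fun p _ ⟨y, hy, hpy⟩ =>
    Finset.card_lt_card (Finset.filter_ssubset.2 ⟨y, hy, hpy⟩)
  have hLUM : zu < zv → {y ∈ X | x y ≤ zu} ∪ {y ∈ X | zu < x y ∧ x y < zv} =
      {y ∈ X | x y < zv} := by
    intro h; ext y; simp; grind
  unfold finish
  simp only [hL, hU, hM, hV, hR, hLU, hRc, hXR]
  split_ifs with h1 h2 h3 h4
  · exact (hasCost_pure ⟨zu, h1, rfl, rfl⟩).mono zero_le
  · have h : zu < zv := by
      refine huv.lt_of_ne fun h => ?_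
      subst h
      have := h2.1.trans_le h2.2
      exact this.not_ge (Finset.card_le_card fun y hy => Finset.mem_union_left _ hy)
    rw [hLUM h] at h2 ⊢
    refine (hasCost_pure ⟨zv, h2, rfl, ?_⟩).mono zero_le
    ext y; simp; grind
  · rw [residualCost, if_pos h3]
    obtain ⟨u, hu, rfl⟩ := hu
    refine (hrec _ k hk1 h3 (hlt _ ⟨u, hu, by simp⟩)).imp fun a ha => ?_
    have := IsSplit.of_block (x := x) (X := X) (D := ∅) (B := {y ∈ X | x y < x u}) (k := k)
      (a := a) (by simp) (Finset.filter_subset _ _) (by simp)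
      (by simp only [Finset.mem_filter]; grind) (by simp; omega) (by simpa using ha)
    simpa using this
  · rw [residualCost, if_neg h3, if_pos h4]
    obtain ⟨v, hv, rfl⟩ := hv
    have hc := hlt (fun y => x v < x y) ⟨v, hv, by simp⟩
    refine ((hrec _ (k - {y ∈ X | x y ≤ x v}.card) (by omega) (by omega) hc).bind
      (c' := 0) fun a ha => hasCost_pure ?_).mono (by simp)
    exact IsSplit.of_block (Finset.filter_subset _ _) (Finset.filter_subset _ _)
      (by simp only [Finset.mem_filter]; grind) (by simp only [Finset.mem_filter]; grind) h4 ha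
  · have h5 : {y ∈ X | x y ≤ zu}.card < k := by
      by_contra h
      exact h1 ⟨not_le.1 h3, not_lt.1 h⟩
    have h : zu < zv := huv.lt_of_ne fun h => by subst h; exact h4 h5
    rw [hLUM h] at h2
    have h6 : k ≤ {y ∈ X | x y < zv}.card := by
      by_contra h
      exact h2 ⟨not_le.1 h, not_lt.1 h4⟩
    rw [residualCost, if_neg h3, if_neg h4, if_pos ⟨h5, h6⟩]
    have h7 : {y ∈ X | x y < zv}.card ≤
        {y ∈ X | x y ≤ zu}.card + {y ∈ X | zu < x y ∧ x y < zv}.card := by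
      rw [← hLUM h]
      exact Finset.card_union_le _ _
    obtain ⟨u, hu, rfl⟩ := hu
    refine ((hrec _ (k - {y ∈ X | x y ≤ x u}.card) (by omega) (by omega)
      (hlt _ ⟨u, hu, by simp⟩)).bind (c' := 0) fun a ha => hasCost_pure ?_).mono (by simp)
    exact IsSplit.of_block (Finset.filter_subset _ _) (Finset.filter_subset _ _)
      (by simp only [Finset.mem_filter]; grind) (by simp only [Finset.mem_filter]; grind) h5 ha

theorem smallest_spec {S : Finset ι} {i : ℕ} {z : κ} {a : Split ι} (hz : IsRank x S i z)
    (hlt : a.lt = {y ∈ S | x y < z}) (heq : a.eq = {y ∈ S | x y = z}) :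
    smallest a i ⊆ S ∧ (smallest a i).card = i ∧ (∀ y ∈ smallest a i, x y ≤ z) ∧
      ∀ y ∈ S, x y < z → y ∈ smallest a i := by
  have hsub : (a.eq.toList.take (i - a.lt.card)).toFinset ⊆ a.eq := fun y hy => by
    simpa using List.mem_of_mem_take (List.mem_toFinset.1 hy)
  have hdisj : Disjoint a.lt a.eq := by
    rw [hlt, heq]
    exact Finset.disjoint_filter.2 fun y _ h => h.ne
  have hcard : a.lt.card + a.eq.card = {y ∈ S | x y ≤ z}.card := by
    rw [← Finset.card_union_of_disjoint hdisj, hlt, heq, ← Finset.filter_or]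
    simp only [le_iff_lt_or_eq]
  have hz1 := hz.1
  have hz2 := hz.2
  rw [← hlt] at hz1
  refine ⟨fun y hy => ?_, ?_, fun y hy => ?_, fun y hy hyz => ?_⟩
  · rcases Finset.mem_union.1 hy with h | h
    · exact (Finset.mem_filter.1 (hlt ▸ h)).1
    · exact (Finset.mem_filter.1 (heq ▸ hsub h)).1
  · rw [smallest, Finset.card_union_of_disjoint (hdisj.mono_right hsub),
      List.toFinset_card_of_nodup ((List.take_sublist _ _).nodup (Finset.nodup_toList _)),
      List.length_take, Finset.length_toList]
    omega
  · rcases Finset.mem_union.1 hy with h | h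
    · exact (Finset.mem_filter.1 (hlt ▸ h)).2.le
    · exact (Finset.mem_filter.1 (heq ▸ hsub h)).2.le
  · exact Finset.mem_union_left _ (hlt ▸ Finset.mem_filter.2 ⟨hy, hyz⟩)

/-- Removing the `i` smallest elements of `S` lowers the ranks of larger keys by `i`. -/
theorem IsRank.of_sdiff {S Q : Finset ι} {i j : ℕ} {zu zv : κ} (hQ : Q ⊆ S) (hi : Q.card = i)
    (hle : ∀ y ∈ Q, x y ≤ zu) (huv : zu ≤ zv) (hij : i < j) (h : IsRank x (S \ Q) (j - i) zv) :
    IsRank x S j zv := by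
  constructor
  · have h1 : {y ∈ S | x y < zv} ⊆ Q ∪ {y ∈ S \ Q | x y < zv} := fun y hy => by
      simp at hy ⊢; tauto
    have h2 := (Finset.card_le_card h1).trans (Finset.card_union_le _ _)
    have := h.1
    omega
  · have h1 : Q ∪ {y ∈ S \ Q | x y ≤ zv} ⊆ {y ∈ S | x y ≤ zv} := fun y hy => by
      have := @hQ y
      have := hle y
      simp at hy ⊢
      grind
    have h2 := Finset.card_le_card h1
    rw [Finset.card_union_of_disjoint] at h2
    · have := h.2
      omega
    · refine Finset.disjoint_left.2 fun y hy hy' => ?_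
      simp at hy'
      tauto

/-- The keys of the two pivots found in the sample `S` for the ranks `iu` and `iv`. -/
structure IsPivotPair (x : ι → κ) (S : Finset ι) (iu iv : ℕ) (zu zv : κ) : Prop where
  rank_left : IsRank x S iu zu
  rank_right : iu < iv → IsRank x S iv zv
  eq_of_le : iv ≤ iu → zv = zu
  le : zu ≤ zv

/-- The number of comparisons to a second pivot and the cost of the final recursive call, when the
sample is `S` and the pivots have keys `zu` and `zv`. -/
noncomputable def pivotCost (c : ℕ → ℝ≥0∞) (x : ι → κ) (X S : Finset ι) (k : ℕ) (zu zv : κ) :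
    ℝ≥0∞ :=
  ({y ∈ X \ S | NeedsBoth (2 * k < X.card) zu zv (x y)}.card : ℕ) + residualCost c x X k zu zv

theorem le_card_of_rankU {n k s : ℕ} {g : ℝ} (hn : 0 < n) (hk : k ≤ n) (hs : 1 ≤ s)
    (hg : 0 ≤ g) : rankU n k s g ≤ s := by
  refine max_le (Nat.ceil_le.2 ?_) hs
  have hn' : (0 : ℝ) < n := by exact_mod_cast hn
  have : (k : ℝ) * s / n ≤ s := by
    rw [div_le_iff₀ hn', mul_comm]
    gcongr
  linarith

/-- One round of `Select`: two recursive calls on the sample at most, one comparison for each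
element outside the sample, and the cost `K S` of second comparisons and of the residual call. -/
theorem body_hasCost {s : ℕ → ℕ} {g : ℕ → ℝ} {recur : Finset ι → ℕ → Prog ι (Split ι)}
    {c : ℕ → ℝ≥0∞} (hc : Monotone c) {X : Finset ι} {k : ℕ} (hk1 : 1 ≤ k) (hkX : k ≤ X.card)
    (hX : X.card ≠ 1) (hs1 : 1 ≤ s X.card) (hsX : s X.card < X.card) (hg : 0 ≤ g X.card)
    (hrec : ∀ Y j, 1 ≤ j → j ≤ Y.card → Y.card < X.card →
      HasCost x (recur Y j) (IsSplit x Y j) (c Y.card))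
    {K : Finset ι → ℝ≥0∞}
    (hK : ∀ S ∈ X.powersetCard (s X.card), ∀ zu zv,
      IsPivotPair x S (rankU X.card k (s X.card) (g X.card))
        (rankV X.card k (s X.card) (g X.card)) zu zv → pivotCost c x X S k zu zv ≤ K S) :
    HasCost x (body s g recur X k) (IsSplit x X k)
      ((∑ S ∈ X.powersetCard (s X.card),
        (2 * c (s X.card) + (X.card - s X.card : ℕ) + K S)) /
          (X.powersetCard (s X.card)).card) := by
  unfold body
  simp only [if_neg hX]
  refine hasCost_drawSample_bind hsX.le fun S hS => ?_
  have hK := hK S hS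
  obtain ⟨hSX, hSc⟩ := Finset.mem_powersetCard.1 hS
  set iu := rankU X.card k (s X.card) (g X.card) with hiu
  set iv := rankV X.card k (s X.card) (g X.card) with hiv
  have hiu1 : 1 ≤ iu := le_max_right _ _
  have hius : iu ≤ S.card := hSc ▸ le_card_of_rankU (by omega) hkX hs1 hg
  have hivs : iv ≤ S.card := hSc ▸ min_le_right _ _
  have hcost : 2 * c (s X.card) + (X.card - s X.card : ℕ) + K S =
      c S.card + (c S.card + (0 + (0 + ((X.card - s X.card : ℕ) + K S)))) := by
    rw [hSc]; ring
  rw [hcost]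
  refine (hrec S iu hiu1 hius (hSc ▸ hsX)).bind fun a ⟨zu, hzu, halt, haeq⟩ => ?_
  -- the second pivot, together with all that the later steps need to know about it
  have hb : HasCost x (if iu < iv then recur (S \ smallest a iu) (iv - iu) else pure a)
      (fun b => ∃ zv, IsPivotPair x S iu iv zu zv ∧ b.eq.Nonempty ∧
        (∀ y ∈ b.eq, y ∈ S ∧ x y = zv) ∧
        ∀ y ∈ S, sampleBlock a b y = keyBlock zu zv (x y)) (c S.card) := by
    obtain ⟨hQ, hQc, hQle, hQlt⟩ := smallest_spec hzu halt haeq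
    split_ifs with h
    · have hSQ : (S \ smallest a iu).card = S.card - iu := by
        rw [Finset.card_sdiff_of_subset hQ, hQc]
      refine ((hrec (S \ smallest a iu) (iv - iu) (by omega) (by omega) (by omega)).mono
        (hc (Finset.card_le_card Finset.sdiff_subset))).imp fun b ⟨zv, hzv, hblt, hbeq⟩ => ?_
      obtain ⟨v, hv, hvz⟩ := hzv.exists_eq
      have hvS := Finset.mem_sdiff.1 hv
      have huv : zu ≤ zv := hvz ▸ not_lt.1 fun hlt => hvS.2 (hQlt v hvS.1 hlt)
      refine ⟨zv, ⟨hzu, fun _ => hzv.of_sdiff hQ hQc hQle huv h, fun h' => by omega, huv⟩,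
        ⟨v, by simp [hbeq, hvz, hvS]⟩, fun y hy => ?_, fun y hy => ?_⟩
      · simp [hbeq] at hy
        tauto
      · have := hQle y
        simp only [sampleBlock, keyBlock, halt, haeq, hblt, hbeq, Finset.mem_filter,
          Finset.mem_sdiff]
        grind
    · refine (hasCost_pure ⟨zu, ⟨hzu, fun h' => absurd h' h, fun _ => rfl, le_rfl⟩, ?_,
        fun y hy => ?_, fun y hy => ?_⟩).mono zero_le
      · obtain ⟨u, hu, huz⟩ := hzu.exists_eq
        exact ⟨u, by simp [haeq, hu, huz]⟩
      · simpa [haeq] using hy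
      · simp only [sampleBlock, keyBlock, halt, haeq, Finset.mem_filter]
        grind
  refine hb.bind fun b ⟨zv, hpair, hbne, hbeq, hblock⟩ => ?_
  have hane : a.eq.Nonempty := by
    obtain ⟨u, hu, huz⟩ := hzu.exists_eq
    exact ⟨u, by simp [haeq, hu, huz]⟩
  refine (hasCost_pick hane).bind fun u hu => (hasCost_pick hbne).bind fun v hv => ?_
  rw [haeq, Finset.mem_filter] at hu
  obtain ⟨huS, rfl⟩ := hu
  obtain ⟨hvS, rfl⟩ := hbeq v hv
  have hsame : decide (v ∈ a.eq) = decide (x u = x v) := by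
    simp [haeq, hvS, eq_comm]
  rw [hsame]
  have hlen : (X \ S).toList.length = X.card - s X.card := by
    rw [Finset.length_toList, Finset.card_sdiff_of_subset hSX, hSc]
  have hcount : (X \ S).toList.countP (fun y => NeedsBoth (2 * k < X.card) (x u) (x v) (x y)) =
      {y ∈ X \ S | NeedsBoth (2 * k < X.card) (x u) (x v) (x y)}.card := by
    rw [← Multiset.coe_countP, Finset.coe_toList, Multiset.countP_eq_card_filter]
    rfl
  refine ((partition_hasCost _ hpair.le (X \ S).toList (sampleBlock a b)).bind
    (c' := residualCost c x X k (x u) (x v)) fun ρ hρ => ?_).mono ?_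
  · refine finish_hasCost hk1 hkX hpair.le ⟨u, hSX huS, rfl⟩ ⟨v, hSX hvS, rfl⟩
      (fun y hy => ?_) hrec
    rw [hρ]
    by_cases hyS : y ∈ S
    · simp [hyS, hblock y hyS]
    · simp [hyS, hy]
  · rw [hlen, hcount, add_assoc]
    gcongr
    exact hK _ _ hpair

end Select

/-! ### Tails of the hypergeometric distribution -/

section Hypergeometric

variable {ι : Type*} [DecidableEq ι]

theorem card_powersetCard_filter_superset_le {X T : Finset ι} (hT : T ⊆ X) (s : ℕ) :
    {S ∈ X.powersetCard s | T ⊆ S}.card ≤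
      if T.card ≤ s then (X.card - T.card).choose (s - T.card) else 0 := by
  split_ifs with h
  · rw [← Finset.card_sdiff_of_subset hT, ← Finset.card_powersetCard]
    refine Finset.card_le_card_of_injOn (· \ T) (fun S hS => ?_) fun S hS S' hS' hSS' => ?_
    · simp only [Finset.coe_filter, Finset.mem_powersetCard, Set.mem_ofPred_eq] at hS
      simp only [Finset.mem_coe, Finset.mem_powersetCard]
      exact ⟨Finset.sdiff_subset_sdiff hS.1.1 subset_rfl,
        by rw [Finset.card_sdiff_of_subset hS.2, hS.1.2]⟩
    · simp only [Finset.coe_filter, Finset.mem_powersetCard, Set.mem_ofPred_eq] at hS hS'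
      rw [← Finset.sdiff_union_of_subset hS.2, ← Finset.sdiff_union_of_subset hS'.2]
      exact congrArg (· ∪ T) hSS'
  · rw [Nat.le_zero, Finset.card_eq_zero, Finset.filter_eq_empty_iff]
    intro S hS hTS
    have := Finset.card_le_card hTS
    rw [(Finset.mem_powersetCard.1 hS).2] at this
    exact h this

theorem descFactorial_mul_pow_le {r n : ℕ} (h : r ≤ n) (j : ℕ) :
    r.descFactorial j * n ^ j ≤ n.descFactorial j * r ^ j := by
  induction j with
  | zero => simp
  | succ j ih =>
    have h1 : (r - j) * n ≤ (n - j) * r := by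
      rw [Nat.sub_mul, Nat.sub_mul, mul_comm n r]
      exact Nat.sub_le_sub_left (Nat.mul_le_mul_left _ h) _
    calc r.descFactorial (j + 1) * n ^ (j + 1)
        = ((r - j) * n) * (r.descFactorial j * n ^ j) := by
          rw [Nat.descFactorial_succ]; ring
      _ ≤ ((n - j) * r) * (n.descFactorial j * r ^ j) := Nat.mul_le_mul h1 ih
      _ = n.descFactorial (j + 1) * r ^ (j + 1) := by
          rw [Nat.descFactorial_succ]; ring

theorem choose_mul_choose_sub_le {r n s j : ℕ} (hr : r ≤ n) (hn : 0 < n) (hj : j ≤ s) :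
    (r.choose j * (n - j).choose (s - j) : ℝ) ≤
      n.choose s * (s.choose j * (r / n : ℝ) ^ j) := by
  have h1 : r.choose j * n ^ j ≤ n.choose j * r ^ j := by
    have := descFactorial_mul_pow_le hr j
    rw [Nat.descFactorial_eq_factorial_mul_choose, Nat.descFactorial_eq_factorial_mul_choose,
      mul_assoc, mul_assoc] at this
    exact Nat.le_of_mul_le_mul_left this (Nat.factorial_pos j)
  have h2 : (r.choose j : ℝ) * n ^ j ≤ n.choose j * r ^ j := by exact_mod_cast h1
  have h3 : (n.choose s * s.choose j : ℝ) = n.choose j * (n - j).choose (s - j) := by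
    exact_mod_cast Nat.choose_mul hj
  have hn' : (0 : ℝ) < n := by exact_mod_cast hn
  rw [← mul_assoc, h3, div_pow, mul_div_assoc', le_div_iff₀ (by positivity)]
  nlinarith [mul_le_mul_of_nonneg_right h2 (Nat.cast_nonneg (α := ℝ) ((n - j).choose (s - j)))]

/-- The generating function of a hypergeometric distribution is at most that of the binomial
distribution with the same mean. -/
theorem sum_pow_card_inter_le {X A : Finset ι} (hA : A ⊆ X) (s : ℕ)
    (hX : 0 < X.card) {t : ℝ} (ht : 0 ≤ t) :
    ∑ S ∈ X.powersetCard s, (1 + t) ^ (S ∩ A).card ≤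
      X.card.choose s * (1 + t * (A.card / X.card)) ^ s := by
  have hr := Finset.card_le_card hA
  calc ∑ S ∈ X.powersetCard s, (1 + t) ^ (S ∩ A).card
      = ∑ S ∈ X.powersetCard s, ∑ T ∈ A.powerset, if T ⊆ S then t ^ T.card else 0 := by
        refine Finset.sum_congr rfl fun S _ => ?_
        rw [add_comm, ← Finset.sum_pow_mul_eq_add_pow, ← Finset.sum_filter]
        simp only [one_pow, mul_one]
        refine Finset.sum_congr ?_ fun _ _ => rfl
        ext T
        simp only [Finset.mem_filter, Finset.mem_powerset, Finset.subset_inter_iff, and_comm]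
    _ = ∑ T ∈ A.powerset, {S ∈ X.powersetCard s | T ⊆ S}.card * t ^ T.card := by
        rw [Finset.sum_comm]
        refine Finset.sum_congr rfl fun T _ => ?_
        rw [← Finset.sum_filter, Finset.sum_const, nsmul_eq_mul]
    _ ≤ ∑ T ∈ A.powerset,
          ((if T.card ≤ s then (X.card - T.card).choose (s - T.card) else 0 : ℕ) : ℝ) *
            t ^ T.card := by
        gcongr with T hT
        exact card_powersetCard_filter_superset_le ((Finset.mem_powerset.1 hT).trans hA) s
    _ = ∑ j ∈ Finset.range (A.card + 1), (A.card.choose j : ℝ) *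
          (((if j ≤ s then (X.card - j).choose (s - j) else 0 : ℕ) : ℝ) * t ^ j) := by
        rw [Finset.sum_powerset_apply_card (fun j =>
          ((if j ≤ s then (X.card - j).choose (s - j) else 0 : ℕ) : ℝ) * t ^ j)]
        simp only [nsmul_eq_mul]
    _ ≤ ∑ j ∈ Finset.range (A.card + 1),
          X.card.choose s * (s.choose j * (A.card / X.card : ℝ) ^ j * t ^ j) := by
        refine Finset.sum_le_sum fun j _ => ?_
        split_ifs with hj
        · have := mul_le_mul_of_nonneg_right (choose_mul_choose_sub_le hr hX hj)
            (pow_nonneg ht j)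
          linarith
        · simp only [Nat.cast_zero, zero_mul, mul_zero]
          positivity
    _ ≤ ∑ j ∈ Finset.range (s + 1),
          X.card.choose s * (s.choose j * (A.card / X.card : ℝ) ^ j * t ^ j) := by
        rw [← Finset.sum_filter_ne_zero]
        refine Finset.sum_le_sum_of_subset_of_nonneg (fun j hj => ?_) fun j _ _ => by positivity
        replace hj := (Finset.mem_filter.1 hj).2
        rw [Finset.mem_range, Nat.lt_succ_iff]
        by_contra h
        simp [Nat.choose_eq_zero_of_lt (not_le.1 h)] at hj
    _ = X.card.choose s * (1 + t * (A.card / X.card)) ^ s := by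
        rw [← Finset.mul_sum, add_comm 1, add_pow]
        congr 1
        refine Finset.sum_congr rfl fun j _ => ?_
        rw [mul_pow]
        ring

/-- Upper tail of the number of sampled elements of `A`. -/
theorem card_filter_add_le_card_inter_le {X A : Finset ι} (hA : A ⊆ X) {s : ℕ} (hs1 : 1 ≤ s)
    (hs : s ≤ X.card) {g : ℝ} (hg : 0 ≤ g) :
    ({S ∈ X.powersetCard s | (A.card : ℝ) * s / X.card + g ≤ (S ∩ A).card}.card : ℝ) ≤
      Real.exp (-(g ^ 2 / (4 * s))) * (X.powersetCard s).card := by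
  have hs0 : (0 : ℝ) < s := by exact_mod_cast hs1
  have hX0 : (0 : ℝ) < X.card := by exact_mod_cast hs1.trans hs
  rcases lt_or_ge (s : ℝ) g with hgs | hgs
  · rw [Finset.filter_false_of_mem]
    · simp only [Finset.card_empty, Nat.cast_zero]
      positivity
    · intro S hS
      have h1 : ((S ∩ A).card : ℝ) ≤ s := by
        have := Finset.card_le_card (Finset.inter_subset_left : S ∩ A ⊆ S)
        rw [(Finset.mem_powersetCard.1 hS).2] at this
        exact_mod_cast this
      have h2 : 0 ≤ (A.card : ℝ) * s / X.card := by positivity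
      linarith
  -- the exponent `l` minimizes `s * l ^ 2 - l * g`
  set l : ℝ := g / (2 * s) with hl
  have hl0 : 0 ≤ l := by positivity
  have hl1 : |l| ≤ 1 := by
    rw [abs_of_nonneg hl0, hl, div_le_one (by positivity)]
    linarith
  set p : ℝ := A.card / X.card with hp
  have hp0 : 0 ≤ p := by positivity
  have hp1 : p ≤ 1 := by
    rw [hp, div_le_one hX0]
    exact_mod_cast Finset.card_le_card hA
  have hmean : (A.card : ℝ) * s / X.card = p * s := by rw [hp]; ring
  rw [hmean]
  have hexp : Real.exp l - 1 ≤ l + l ^ 2 := by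
    have := (abs_le.1 (Real.abs_exp_sub_one_sub_id_le hl1)).2
    linarith
  have hexp0 : 0 ≤ Real.exp l - 1 := by linarith [Real.add_one_le_exp l]
  have hmgf := sum_pow_card_inter_le hA s (hs1.trans hs) hexp0
  have hpow : (1 + (Real.exp l - 1) * p) ^ s ≤ Real.exp (s * (p * l + l ^ 2)) := by
    rw [Real.exp_nat_mul]
    gcongr
    calc 1 + (Real.exp l - 1) * p ≤ (p * l + l ^ 2) + 1 := by
          nlinarith [sq_nonneg l, mul_le_mul_of_nonneg_right hexp hp0]
      _ ≤ _ := Real.add_one_le_exp _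
  have hmarkov :
      ({S ∈ X.powersetCard s | p * s + g ≤ (S ∩ A).card}.card : ℝ) * Real.exp (l * (p * s + g)) ≤
        ∑ S ∈ X.powersetCard s, (1 + (Real.exp l - 1)) ^ (S ∩ A).card := by
    rw [← nsmul_eq_mul, ← Finset.sum_const]
    refine (Finset.sum_le_sum fun S hS => ?_).trans
      (Finset.sum_le_sum_of_subset_of_nonneg (Finset.filter_subset _ _)
        fun S _ _ => by positivity)
    rw [add_sub_cancel, ← Real.exp_nat_mul, mul_comm]
    gcongr
    exact (Finset.mem_filter.1 hS).2
  rw [Finset.card_powersetCard]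
  have h1 := hmarkov.trans (hmgf.trans (mul_le_mul_of_nonneg_left hpow (Nat.cast_nonneg _)))
  have h2 : Real.exp (s * (p * l + l ^ 2)) =
      Real.exp (-(g ^ 2 / (4 * s))) * Real.exp (l * (p * s + g)) := by
    rw [← Real.exp_add]
    congr 1
    rw [hl]
    field_simp
    ring
  rw [h2, ← mul_assoc] at h1
  have h3 := le_of_mul_le_mul_right h1 (Real.exp_pos _)
  linarith

/-- Lower tail of the number of sampled elements of `A`. -/
theorem card_filter_card_inter_lt_sub_le {X A : Finset ι} (hA : A ⊆ X) {s : ℕ} (hs1 : 1 ≤ s)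
    (hs : s ≤ X.card) {g : ℝ} (hg : 0 ≤ g) :
    ({S ∈ X.powersetCard s | ((S ∩ A).card : ℝ) < (A.card : ℝ) * s / X.card - g}.card : ℝ) ≤
      Real.exp (-(g ^ 2 / (4 * s))) * (X.powersetCard s).card := by
  have hX0 : (0 : ℝ) < X.card := by exact_mod_cast hs1.trans hs
  refine le_trans ?_ (card_filter_add_le_card_inter_le (A := X \ A) Finset.sdiff_subset hs1 hs hg)
  refine Nat.cast_le.2 (Finset.card_le_card fun S hS => ?_)
  simp only [Finset.mem_filter, Finset.mem_powersetCard] at hS ⊢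
  refine ⟨hS.1, ?_⟩
  have h1 : (S ∩ A).card + (S ∩ (X \ A)).card = s := by
    rw [← hS.1.2, ← Finset.card_inter_add_card_sdiff S A]
    congr 2
    ext y
    have := @hS.1.1 y
    simp
    tauto
  have h2 : (X \ A).card + A.card = X.card := Finset.card_sdiff_add_card_eq_card hA
  have h1' : ((S ∩ A).card : ℝ) + (S ∩ (X \ A)).card = s := by exact_mod_cast h1
  have h2' : ((X \ A).card : ℝ) = X.card - A.card := by
    rw [← h2]; push_cast; ring
  have h3 : ((X \ A).card : ℝ) * s / X.card = s - A.card * s / X.card := by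
    rw [h2']
    field_simp
  have := hS.2
  linarith

end Hypergeometric

/-! ### Pivots of a random sample -/

namespace Select

open Prog

variable {ι : Type} [DecidableEq ι] {κ : Type*} [LinearOrder κ] {x : ι → κ}

/-- `A` consists of `A.card` smallest elements of `X`, where ties are broken arbitrarily. Counting
the sampled elements of such sets locates the pivots also when keys are repeated. -/
structure IsInitial (x : ι → κ) (X A : Finset ι) : Prop where
  subset : A ⊆ X
  le : ∀ a ∈ A, ∀ b ∈ X, b ∉ A → x a ≤ x b

theorem exists_isInitial (x : ι → κ) (X : Finset ι) {m : ℕ} (hm : m ≤ X.card) :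
    ∃ A, IsInitial x X A ∧ A.card = m := by
  induction m with
  | zero => exact ⟨∅, ⟨by simp, by simp⟩, rfl⟩
  | succ m ih =>
    obtain ⟨A, hA, hAm⟩ := ih (by omega)
    have hne : (X \ A).Nonempty := by
      rw [← Finset.card_pos, Finset.card_sdiff_of_subset hA.subset]
      omega
    obtain ⟨b, hb, hmin⟩ := Finset.exists_min_image (X \ A) x hne
    obtain ⟨hbX, hbA⟩ := Finset.mem_sdiff.1 hb
    refine ⟨insert b A, ⟨Finset.insert_subset hbX hA.subset, fun a ha c hc hcA => ?_⟩,
      by rw [Finset.card_insert_of_notMem hbA, hAm]⟩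
    rw [Finset.mem_insert, not_or] at hcA
    rcases Finset.mem_insert.1 ha with rfl | ha
    · exact hmin c (Finset.mem_sdiff.2 ⟨hc, hcA.2⟩)
    · exact hA.le a ha c hc hcA.2

theorem IsRank.card_lt_of_card_inter_lt {X S A : Finset ι} {i : ℕ} {z : κ} (hA : IsInitial x X A)
    (hS : S ⊆ X) (hz : IsRank x S i z) (h : (S ∩ A).card < i) :
    A.card < {y ∈ X | x y ≤ z}.card := by
  have hex : ∃ y ∈ S, y ∉ A ∧ x y ≤ z := by
    by_contra! hno
    have hsub : {y ∈ S | x y ≤ z} ⊆ S ∩ A := fun y hy => by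
      obtain ⟨hyS, hyz⟩ := Finset.mem_filter.1 hy
      refine Finset.mem_inter.2 ⟨hyS, ?_⟩
      by_contra hyA
      exact (hno y hyS hyA).not_ge hyz
    have := Finset.card_le_card hsub
    have := hz.2
    omega
  obtain ⟨y, hyS, hyA, hyz⟩ := hex
  refine Finset.card_lt_card (Finset.ssubset_iff_of_subset (fun a ha => ?_) |>.2
    ⟨y, Finset.mem_filter.2 ⟨hS hyS, hyz⟩, hyA⟩)
  exact Finset.mem_filter.2 ⟨hA.subset ha, (hA.le a ha y (hS hyS) hyA).trans hyz⟩

theorem IsRank.card_lt_of_le_card_inter {X S A : Finset ι} {i : ℕ} {z : κ}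
    (hA : IsInitial x X A) (hz : IsRank x S i z) (h : i ≤ (S ∩ A).card) :
    {y ∈ X | x y < z}.card < A.card := by
  have hex : ∃ a ∈ A, z ≤ x a := by
    by_contra! hno
    have hsub : S ∩ A ⊆ {y ∈ S | x y < z} := fun y hy => by
      obtain ⟨hyS, hyA⟩ := Finset.mem_inter.1 hy
      exact Finset.mem_filter.2 ⟨hyS, hno y hyA⟩
    have := Finset.card_le_card hsub
    have := hz.1
    omega
  obtain ⟨a, haA, haz⟩ := hex
  refine Finset.card_lt_card (Finset.ssubset_iff_of_subset (fun y hy => ?_) |>.2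
    ⟨a, haA, fun ha => (Finset.mem_filter.1 ha).2.not_ge haz⟩)
  obtain ⟨hyX, hyz⟩ := Finset.mem_filter.1 hy
  by_contra hyA
  exact (hyz.trans_le (haz.trans (hA.le a haA y hyX hyA))).false

omit [DecidableEq ι] in
theorem card_filter_gt_add (x : ι → κ) (X : Finset ι) (z : κ) :
    {y ∈ X | z < x y}.card + {y ∈ X | x y ≤ z}.card = X.card := by
  have := Finset.card_filter_add_card_filter_not (s := X) (fun y => z < x y)
  simpa only [not_lt] using this

/-- Bounds on the ranks in `X` of the pivot keys bound the cost of the rest of the round. -/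
theorem pivotCost_le {c : ℕ → ℝ≥0∞} (hc : Monotone c) {X S : Finset ι} {k : ℕ}
    {t : ℝ} {zu zv : κ}
    (h1 : (k : ℝ) - 2 * t ≤ {y ∈ X | x y ≤ zu}.card)
    (h2 : k ≤ {y ∈ X | x y < zu}.card → ({y ∈ X | x y < zu}.card : ℝ) ≤ t)
    (h3 : {y ∈ X | x y ≤ zv}.card < k → (X.card : ℝ) - t ≤ {y ∈ X | x y ≤ zv}.card)
    (h4 : ({y ∈ X | x y < zv}.card : ℝ) ≤ k + 2 * t) (ht : 0 ≤ t) :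
    pivotCost c x X S k zu zv ≤
      ENNReal.ofReal (min (k : ℝ) (X.card - k) + 2 * t) + c ⌊4 * t⌋₊ := by
  have hgt := card_filter_gt_add x X zu
  have hgt' := card_filter_gt_add x X zv
  have hgtR : ({y ∈ X | zu < x y}.card : ℝ) + {y ∈ X | x y ≤ zu}.card = X.card := by
    exact_mod_cast hgt
  have hgtR' : ({y ∈ X | zv < x y}.card : ℝ) + {y ∈ X | x y ≤ zv}.card = X.card := by
    exact_mod_cast hgt'
  unfold pivotCost
  gcongr ?_ + ?_
  · rw [← ENNReal.ofReal_natCast]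
    refine ENNReal.ofReal_le_ofReal ?_
    by_cases hkn : 2 * k < X.card
    · have hmin : min (k : ℝ) (X.card - k) = k := min_eq_left (by
        have : (2 * k : ℝ) < X.card := by exact_mod_cast hkn
        linarith)
      have hle : {y ∈ X \ S | NeedsBoth (decide (2 * k < X.card)) zu zv (x y)}.card ≤
          {y ∈ X | x y < zv}.card := Finset.card_le_card fun y hy => by
        simp [NeedsBoth, hkn] at hy ⊢
        tauto
      rw [hmin]
      exact (Nat.cast_le.2 hle).trans h4
    · have hmin : min (k : ℝ) (X.card - k) = X.card - k := min_eq_right (by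
        have : (X.card : ℝ) ≤ 2 * k := by exact_mod_cast not_lt.1 hkn
        linarith)
      have hle : {y ∈ X \ S | NeedsBoth (decide (2 * k < X.card)) zu zv (x y)}.card ≤
          {y ∈ X | zu < x y}.card := Finset.card_le_card fun y hy => by
        simp [NeedsBoth, hkn] at hy ⊢
        tauto
      rw [hmin]
      have := (Nat.cast_le (α := ℝ)).2 hle
      linarith
  · unfold residualCost
    split_ifs with hL hR hM
    · exact hc (Nat.le_floor (by linarith [h2 hL]))
    · exact hc (Nat.le_floor (by linarith [h3 hR]))
    · have huv : zu < zv := by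
        by_contra h
        have := Finset.card_le_card (s := {y ∈ X | x y < zv}) (t := {y ∈ X | x y ≤ zu})
          fun y hy => by simp at hy ⊢; exact ⟨hy.1, hy.2.le.trans (not_lt.1 h)⟩
        omega
      have hsum : {y ∈ X | zu < x y ∧ x y < zv}.card + {y ∈ X | x y ≤ zu}.card =
          {y ∈ X | x y < zv}.card := by
        rw [← Finset.card_union_of_disjoint]
        · congr 1
          ext y; simp; grind
        · refine Finset.disjoint_left.2 fun y hy hy' => ?_
          simp at hy hy'
          exact hy.2.1.not_ge hy'.2
      have hsumR : ({y ∈ X | zu < x y ∧ x y < zv}.card : ℝ) + {y ∈ X | x y ≤ zu}.card =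
          {y ∈ X | x y < zv}.card := by exact_mod_cast hsum
      exact hc (Nat.le_floor (by linarith))
    · exact zero_le

/-- The rest of the round costs at most one more comparison per element and a call on a smaller
set, whatever the pivots are. -/
theorem pivotCost_le_crude {c : ℕ → ℝ≥0∞} (hc : Monotone c) {X S : Finset ι} (hS : S ⊆ X)
    (k : ℕ) {iu iv : ℕ} {zu zv : κ} (h : IsPivotPair x S iu iv zu zv) :
    pivotCost c x X S k zu zv ≤ X.card + c (X.card - 1) := by
  obtain ⟨u, hu, rfl⟩ := h.rank_left.exists_eq
  have hv : ∃ v ∈ S, x v = zv := by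
    by_cases hlt : iu < iv
    · exact (h.rank_right hlt).exists_eq
    · exact ⟨u, hu, (h.eq_of_le (not_lt.1 hlt)).symm⟩
  obtain ⟨v, hv, rfl⟩ := hv
  have hlt : ∀ p : ι → Prop, ∀ [DecidablePred p], (∃ y ∈ X, ¬ p y) →
      (X.filter p).card ≤ X.card - 1 := fun p _ ⟨y, hy, hpy⟩ =>
    Nat.le_sub_one_of_lt (Finset.card_lt_card (Finset.filter_ssubset.2 ⟨y, hy, hpy⟩))
  unfold pivotCost
  gcongr
  · exact (Finset.filter_subset _ _).trans Finset.sdiff_subset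
  · unfold residualCost
    split_ifs
    · exact hc (hlt _ ⟨u, hS hu, by simp⟩)
    · exact hc (hlt _ ⟨v, hS hv, by simp⟩)
    · exact hc (hlt _ ⟨u, hS hu, by simp⟩)
    · exact zero_le

/-- In all but a fraction `4 * exp (-g ^ 2 / (4 * s))` of the samples, the ranks of the pivots in
`X` are as intended, up to an error of order `t = n * g / s`. -/
theorem exists_bad_samples (x : ι → κ) {X : Finset ι} {k s : ℕ} {g t : ℝ} (hk1 : 1 ≤ k)
    (hk : k ≤ X.card) (hs1 : 1 ≤ s) (hs : s ≤ X.card) (hg : 0 ≤ g) (ht : t = X.card * g / s) :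
    ∃ B ⊆ X.powersetCard s,
      (B.card : ℝ) ≤ 4 * Real.exp (-(g ^ 2 / (4 * s))) * (X.powersetCard s).card ∧
      ∀ S ∈ X.powersetCard s, S ∉ B → ∀ zu zv,
        IsPivotPair x S (rankU X.card k s g) (rankV X.card k s g) zu zv →
        ∀ c : ℕ → ℝ≥0∞, Monotone c → pivotCost c x X S k zu zv ≤
          ENNReal.ofReal (min (k : ℝ) (X.card - k) + 2 * t) + c ⌊4 * t⌋₊ := by
  have hs0 : (0 : ℝ) < s := by exact_mod_cast hs1
  have hn0 : (0 : ℝ) < X.card := by exact_mod_cast hs1.trans hs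
  have hk0 : (0 : ℝ) < k := by exact_mod_cast hk1
  have ht0 : 0 ≤ t := by rw [ht]; positivity
  have hts : t * s / X.card = g := by rw [ht]; field_simp
  -- expected numbers of sampled elements are monotone in the size of the set
  have hscale : ∀ a b : ℝ, a ≤ b → a * s / X.card ≤ b * s / X.card := fun a b h => by gcongr
  have hk2 : ((k : ℝ) - 2 * t) * s / X.card = k * s / X.card - 2 * g := by rw [← hts]; ring
  have hk2' : ((k : ℝ) + 2 * t) * s / X.card = k * s / X.card + 2 * g := by rw [← hts]; ring
  have hnt : ((X.card : ℝ) - t) * s / X.card = s - g := by rw [← hts]; field_simp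
  have hks : 0 < (k : ℝ) * s / X.card := by positivity
  have hA : ∀ m : ℕ, ∃ A, IsInitial x X A ∧ A.card = min m X.card := fun m =>
    exists_isInitial x X (min_le_right _ _)
  choose A hAi hAc using hA
  set m1 := ⌊(k : ℝ) - 2 * t⌋₊ with hm1
  set m2 := max k (⌊t⌋₊ + 1) with hm2
  set m3 := min k ⌊(X.card : ℝ) - t⌋₊ with hm3
  set m4 := ⌈(k : ℝ) + 2 * t⌉₊ with hm4
  let up : ℕ → Finset (Finset ι) := fun m =>
    {S ∈ X.powersetCard s | ((A m).card : ℝ) * s / X.card + g ≤ (S ∩ A m).card}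
  let lo : ℕ → Finset (Finset ι) := fun m =>
    {S ∈ X.powersetCard s | ((S ∩ A m).card : ℝ) < ((A m).card : ℝ) * s / X.card - g}
  refine ⟨(up m1 ∪ lo m2) ∪ (up m3 ∪ lo m4), ?_, ?_, ?_⟩
  · simp only [Finset.union_subset_iff]
    exact ⟨⟨Finset.filter_subset _ _, Finset.filter_subset _ _⟩, Finset.filter_subset _ _,
      Finset.filter_subset _ _⟩
  · have hcard : (((up m1 ∪ lo m2) ∪ (up m3 ∪ lo m4)).card : ℝ) ≤
        ((up m1).card + (lo m2).card) + ((up m3).card + (lo m4).card) := by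
      exact_mod_cast (Finset.card_union_le _ _).trans
        (add_le_add (Finset.card_union_le _ _) (Finset.card_union_le _ _))
    have hup : ∀ m, ((up m).card : ℝ) ≤ _ := fun m =>
      card_filter_add_le_card_inter_le (hAi m).subset hs1 hs hg
    have hlo : ∀ m, ((lo m).card : ℝ) ≤ _ := fun m =>
      card_filter_card_inter_lt_sub_le (hAi m).subset hs1 hs hg
    linarith [hup m1, hlo m2, hup m3, hlo m4]
  intro S hS hgood zu zv hpair c hc
  have hSX := (Finset.mem_powersetCard.1 hS).1
  simp only [up, lo, Finset.mem_union, Finset.mem_filter, hS, true_and, not_or, not_le,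
    not_lt, hAc] at hgood
  obtain ⟨⟨g1, g2⟩, g3, g4⟩ := hgood
  have hceil : 1 ≤ ⌈(k : ℝ) * s / X.card + g⌉₊ :=
    Nat.one_le_ceil_iff.2 (by linarith)
  have hmid : ⌈(k : ℝ) * s / X.card - g⌉₊ ≤ ⌈(k : ℝ) * s / X.card + g⌉₊ :=
    Nat.ceil_mono (by linarith)
  -- the rank of the second pivot, also when the two pivots coincide
  obtain ⟨j, hj, hvj, hjle⟩ : ∃ j, IsRank x S j zv ∧ rankV X.card k s g ≤ j ∧
      j ≤ ⌈(k : ℝ) * s / X.card + g⌉₊ := by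
    by_cases h : rankU X.card k s g < rankV X.card k s g
    · exact ⟨_, hpair.rank_right h, le_rfl, min_le_left _ _⟩
    · refine ⟨_, hpair.eq_of_le (not_lt.1 h) ▸ hpair.rank_left, not_lt.1 h, max_le hmid hceil⟩
  refine pivotCost_le hc ?_ ?_ ?_ ?_ ht0
  · have hlt : (S ∩ A m1).card < rankU X.card k s g := by
      rcases Nat.eq_zero_or_pos m1 with h | h
      · have : (A m1).card = 0 := by rw [hAc, h, Nat.zero_min]
        rw [Finset.card_eq_zero.1 this, Finset.inter_empty, Finset.card_empty]
        exact Nat.lt_of_lt_of_le one_pos (le_max_right _ _)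
      · refine lt_of_lt_of_le (Nat.lt_ceil.2 ?_) (le_max_left _ _)
        have h0 : 0 ≤ (k : ℝ) - 2 * t := (Nat.pos_of_floor_pos h).le
        have h1 : ((min m1 X.card : ℕ) : ℝ) ≤ k - 2 * t :=
          (Nat.cast_le.2 (min_le_left _ _)).trans (Nat.floor_le h0)
        have := hscale _ _ h1
        linarith
    have hlt' := hpair.rank_left.card_lt_of_card_inter_lt (hAi m1) hSX hlt
    have hm1X : m1 ≤ X.card := (Nat.floor_le_of_le (by linarith)).trans hk
    rw [hAc, min_eq_left hm1X] at hlt'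
    have h1 : ((m1 + 1 : ℕ) : ℝ) ≤ {y ∈ X | x y ≤ zu}.card := by exact_mod_cast hlt'
    push_cast at h1
    linarith [Nat.lt_floor_add_one ((k : ℝ) - 2 * t)]
  · intro hkL
    have hlt : {y ∈ X | x y < zu}.card < m2 := by
      rcases le_or_gt m2 X.card with h | h
      · rw [min_eq_left h] at g2
        have hle : rankU X.card k s g ≤ (S ∩ A m2).card := by
          refine max_le (Nat.ceil_le.2 ?_) ?_
          · have : (k : ℝ) ≤ m2 := by exact_mod_cast le_max_left _ _
            have := hscale _ _ this
            linarith
          · have h1 : t < m2 := (Nat.lt_floor_add_one t).trans_le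
              (by exact_mod_cast le_max_right k (⌊t⌋₊ + 1))
            have h2 : t * s / X.card < m2 * s / X.card := by gcongr
            have h3 : (0 : ℝ) < (S ∩ A m2).card := by linarith
            exact_mod_cast h3
        have := hpair.rank_left.card_lt_of_le_card_inter (hAi m2) hle
        rwa [hAc, min_eq_left h] at this
      · exact (Finset.card_filter_le _ _).trans_lt h
    have hlt' : {y ∈ X | x y < zu}.card ≤ ⌊t⌋₊ := by omega
    exact (Nat.cast_le.2 hlt').trans (Nat.floor_le ht0)
  · intro hkR
    have hm3X : m3 ≤ X.card := (min_le_left _ _).trans hk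
    rw [min_eq_left hm3X] at g3
    have hlt : (S ∩ A m3).card < rankV X.card k s g := by
      rcases Nat.eq_zero_or_pos m3 with h | h
      · have : (A m3).card = 0 := by rw [hAc, h, Nat.zero_min]
        rw [Finset.card_eq_zero.1 this, Finset.inter_empty, Finset.card_empty]
        exact lt_min hceil hs1
      · refine lt_min (Nat.lt_ceil.2 ?_) ?_
        · have : (m3 : ℝ) ≤ k := by exact_mod_cast min_le_left _ _
          have := hscale _ _ this
          linarith
        · have h0 : 0 ≤ (X.card : ℝ) - t :=
            (Nat.pos_of_floor_pos (h.trans_le (min_le_right _ _))).le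
          have h1 : (m3 : ℝ) ≤ X.card - t :=
            (Nat.cast_le.2 (min_le_right _ _)).trans (Nat.floor_le h0)
          have h2 := hscale _ _ h1
          have h3 : ((S ∩ A m3).card : ℝ) < s := by linarith
          exact_mod_cast h3
    have hlt' := hj.card_lt_of_card_inter_lt (hAi m3) hSX (hlt.trans_le hvj)
    rw [hAc, min_eq_left hm3X] at hlt'
    have h1 : ⌊(X.card : ℝ) - t⌋₊ + 1 ≤ {y ∈ X | x y ≤ zv}.card := by omega
    have h2 : ((⌊(X.card : ℝ) - t⌋₊ : ℝ) + 1) ≤ {y ∈ X | x y ≤ zv}.card := by exact_mod_cast h1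
    linarith [Nat.lt_floor_add_one ((X.card : ℝ) - t)]
  · have hlt : {y ∈ X | x y < zv}.card < m4 := by
      rcases le_or_gt m4 X.card with h | h
      · rw [min_eq_left h] at g4
        have hle : j ≤ (S ∩ A m4).card := by
          refine hjle.trans (Nat.ceil_le.2 ?_)
          have := hscale _ _ (Nat.le_ceil ((k : ℝ) + 2 * t))
          linarith
        have := hj.card_lt_of_le_card_inter (hAi m4) hle
        rwa [hAc, min_eq_left h] at this
      · exact (Finset.card_filter_le _ _).trans_lt h
    exact (Nat.lt_ceil.1 hlt).le

end Select

/-! ### Recurrences for the expected number of comparisons -/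

namespace Select

open Prog

variable {ι : Type} [DecidableEq ι] {κ : Type*} [LinearOrder κ] {x : ι → κ}

theorem body_hasCost_of_card_eq_one {s : ℕ → ℕ} {g : ℕ → ℝ}
    {recur : Finset ι → ℕ → Prog ι (Split ι)} {X : Finset ι} {k : ℕ} (hk1 : 1 ≤ k)
    (hkX : k ≤ X.card) (hX : X.card = 1) :
    HasCost x (body s g recur X k) (IsSplit x X k) 0 := by
  unfold body
  simp only [if_pos hX]
  obtain ⟨i, rfl⟩ := Finset.card_eq_one.1 hX
  obtain rfl : k = 1 := by omega
  refine hasCost_pure ⟨x i, ⟨?_, ?_⟩, ?_, ?_⟩ <;> simp [Finset.filter_singleton]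

/-- The worst-case recurrence of `Select`. -/
theorem body_hasCost_crude {s : ℕ → ℕ} {g : ℕ → ℝ} {recur : Finset ι → ℕ → Prog ι (Split ι)}
    {c : ℕ → ℝ≥0∞} (hc : Monotone c) {X : Finset ι} {k : ℕ} (hk1 : 1 ≤ k) (hkX : k ≤ X.card)
    (hX : X.card ≠ 1) (hs1 : 1 ≤ s X.card) (hsX : s X.card < X.card) (hg : 0 ≤ g X.card)
    (hrec : ∀ Y j, 1 ≤ j → j ≤ Y.card → Y.card < X.card →
      HasCost x (recur Y j) (IsSplit x Y j) (c Y.card)) :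
    HasCost x (body s g recur X k) (IsSplit x X k) (3 * c (X.card - 1) + 2 * X.card) := by
  refine (body_hasCost hc hk1 hkX hX hs1 hsX hg hrec (K := fun _ => X.card + c (X.card - 1))
    fun S hS zu zv h =>
      pivotCost_le_crude hc (Finset.mem_powersetCard.1 hS).1 k h).mono ?_
  refine ENNReal.div_le_of_le_mul ?_
  rw [Finset.sum_const, nsmul_eq_mul, mul_comm]
  refine mul_le_mul' ?_ le_rfl
  calc 2 * c (s X.card) + (X.card - s X.card : ℕ) + (X.card + c (X.card - 1))
      ≤ 2 * c (X.card - 1) + X.card + (X.card + c (X.card - 1)) := by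
        gcongr
        · exact hc (Nat.le_sub_one_of_lt hsX)
        · exact Nat.sub_le _ _
    _ = _ := by ring

/-- The average-case recurrence of `Select`: up to an event of small probability, the residual
recursive call is on a set of size at most `4 * t`, where `t = n * g / s`. -/
theorem body_hasCost_average {s : ℕ → ℕ} {g : ℕ → ℝ} {recur : Finset ι → ℕ → Prog ι (Split ι)}
    {c : ℕ → ℝ≥0∞} (hc : Monotone c) {X : Finset ι} {k : ℕ} (hk1 : 1 ≤ k) (hkX : k ≤ X.card)
    (hX : X.card ≠ 1) (hs1 : 1 ≤ s X.card) (hsX : s X.card < X.card) (hg : 0 ≤ g X.card)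
    (hrec : ∀ Y j, 1 ≤ j → j ≤ Y.card → Y.card < X.card →
      HasCost x (recur Y j) (IsSplit x Y j) (c Y.card))
    {t : ℝ} (ht : t = X.card * g X.card / s X.card) :
    HasCost x (body s g recur X k) (IsSplit x X k)
      (2 * c (s X.card) + (X.card - s X.card : ℕ) +
        (ENNReal.ofReal (min (k : ℝ) (X.card - k) + 2 * t) + c ⌊4 * t⌋₊) +
        ENNReal.ofReal (4 * Real.exp (-(g X.card ^ 2 / (4 * s X.card)))) *
          (X.card + c X.card)) := by
  obtain ⟨B, hB, hBc, hgood⟩ := exists_bad_samples x hk1 hkX hs1 hsX.le hg ht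
  refine (body_hasCost hc hk1 hkX hX hs1 hsX hg hrec
    (K := fun S => (ENNReal.ofReal (min (k : ℝ) (X.card - k) + 2 * t) + c ⌊4 * t⌋₊) +
      if S ∈ B then X.card + c X.card else 0) fun S hS zu zv h => ?_).mono ?_
  · by_cases hSB : S ∈ B
    · rw [if_pos hSB]
      refine (pivotCost_le_crude hc (Finset.mem_powersetCard.1 hS).1 k h).trans
        (le_trans ?_ le_add_self)
      gcongr
      exact hc (Nat.sub_le _ _)
    · rw [if_neg hSB, add_zero]
      exact hgood S hS hSB zu zv h c hc
  · refine ENNReal.div_le_of_le_mul ?_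
    simp only [← add_assoc]
    rw [Finset.sum_add_distrib, Finset.sum_const, nsmul_eq_mul, add_mul, ← Finset.sum_filter,
      Finset.filter_mem_eq_inter, Finset.inter_eq_right.2 hB, Finset.sum_const, nsmul_eq_mul]
    have hBc' : (B.card : ℝ≥0∞) ≤
        ENNReal.ofReal (4 * Real.exp (-(g X.card ^ 2 / (4 * s X.card)))) *
          (X.powersetCard (s X.card)).card := by
      rw [← ENNReal.ofReal_natCast, ← ENNReal.ofReal_natCast (X.powersetCard (s X.card)).card,
        ← ENNReal.ofReal_mul (by positivity)]
      exact ENNReal.ofReal_le_ofReal hBc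
    gcongr ?_ + ?_
    · rw [mul_comm]
    · rw [mul_right_comm]
      gcongr

theorem upToDepth_hasCost_crude {s : ℕ → ℕ} {g : ℕ → ℝ}
    (hs : ∀ n, 2 ≤ n → 1 ≤ s n ∧ s n < n) (hg : ∀ n, 0 ≤ g n) (d : ℕ) :
    ∀ (X : Finset ι) (k : ℕ), 1 ≤ k → k ≤ X.card → X.card ≤ d →
      HasCost x (upToDepth s g d X k) (IsSplit x X k) (4 ^ (X.card + 1)) := by
  induction d with
  | zero => intro X k h1 h2 h3; omega
  | succ d ih =>
    intro X k hk1 hkX hXd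
    rw [upToDepth]
    by_cases hX : X.card = 1
    · exact (body_hasCost_of_card_eq_one hk1 hkX hX).mono zero_le
    obtain ⟨hs1, hsX⟩ := hs X.card (by omega)
    have hc : Monotone fun m : ℕ => (4 : ℝ≥0∞) ^ (m + 1) := fun a b hab =>
      pow_le_pow_right₀ (by norm_num) (by omega)
    refine (body_hasCost_crude hc hk1 hkX hX hs1 hsX (hg _) fun Y j hj hjY hYX =>
      ih Y j hj hjY (by omega)).mono ?_
    have h1 : X.card - 1 + 1 = X.card := by omega
    have h2 : 2 * X.card ≤ 4 ^ X.card :=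
      calc 2 * X.card ≤ 2 * 2 ^ X.card := by gcongr; exact Nat.lt_two_pow_self.le
        _ ≤ 2 ^ X.card * 2 ^ X.card := by
          gcongr
          exact Nat.le_self_pow (by omega) 2
        _ = 4 ^ X.card := by rw [← mul_pow]; norm_num
    have h3 : (2 * X.card : ℝ≥0∞) ≤ 4 ^ X.card := by exact_mod_cast h2
    rw [h1]
    calc 3 * (4 : ℝ≥0∞) ^ X.card + 2 * X.card ≤ 3 * (4 : ℝ≥0∞) ^ X.card + 4 ^ X.card := by
          gcongr
      _ = 4 ^ (X.card + 1) := by ring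

/-- The solution of the average-case recurrence. The first hypothesis on large `n` bounds the
linear overhead of a round; the second says that the recursive calls other than the accounted
linear ones consume at most half of the error term. -/
theorem upToDepth_hasCost {s : ℕ → ℕ} {g : ℕ → ℝ} {η C γ : ℝ} {N : ℕ}
    (hs : ∀ n, 2 ≤ n → 1 ≤ s n ∧ s n < n) (hg : ∀ n, 0 ≤ g n) (hη : 0 < η) (hN : 2 ≤ N)
    (hlin : ∀ n : ℕ, N ≤ n → 2 * (s n : ℝ) + 8 * (n * g n / s n) +
      10 * (Real.exp (-(g n ^ 2 / (4 * s n))) * n) ≤ C * (n : ℝ) ^ η)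
    (hpow : ∀ n : ℕ, N ≤ n → 2 * (s n : ℝ) ^ η + (4 * (n * g n / s n)) ^ η +
      4 * (Real.exp (-(g n ^ 2 / (4 * s n))) * (n : ℝ) ^ η) ≤ (n : ℝ) ^ η / 2)
    (hγC : 2 * C ≤ γ) (hγN : 4 ^ (N + 1) ≤ γ) (d : ℕ) :
    ∀ (X : Finset ι) (k : ℕ), 1 ≤ k → k ≤ X.card → X.card ≤ d →
      HasCost x (upToDepth s g d X k) (IsSplit x X k)
        (ENNReal.ofReal ((X.card : ℝ) + min (k : ℝ) (X.card - k) + γ * (X.card : ℝ) ^ η)) := by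
  have hγ0 : 0 ≤ γ := le_trans (by positivity) hγN
  induction d with
  | zero => intro X k h1 h2 h3; omega
  | succ d ih =>
    intro X k hk1 hkX hXd
    set n := X.card with hn
    have hkn : (k : ℝ) ≤ n := by exact_mod_cast hkX
    have hmin : 0 ≤ min (k : ℝ) (n - k) := le_min (by positivity) (by linarith)
    have hn1 : (1 : ℝ) ≤ n := by exact_mod_cast hk1.trans hkX
    have hnη : 1 ≤ (n : ℝ) ^ η := Real.one_le_rpow hn1 hη.le
    rcases lt_or_ge n N with hnN | hnN
    · refine (upToDepth_hasCost_crude hs hg (d + 1) X k hk1 hkX hXd).mono ?_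
      have h4 : (4 : ℝ≥0∞) ^ (X.card + 1) = ENNReal.ofReal (4 ^ (X.card + 1)) := by
        rw [ENNReal.ofReal_pow (by norm_num)]
        norm_num
      rw [h4]
      refine ENNReal.ofReal_le_ofReal ?_
      have h5 : (4 : ℝ) ^ (X.card + 1) ≤ 4 ^ (N + 1) :=
        pow_le_pow_right₀ (by norm_num) (by omega)
      nlinarith
    obtain ⟨hs1, hsX⟩ := hs n (by omega)
    let c : ℕ → ℝ≥0∞ := fun m => ENNReal.ofReal (3 / 2 * m + γ * (m : ℝ) ^ η)
    have hc : Monotone c := fun a b hab => by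
      have hab' : (a : ℝ) ≤ b := by exact_mod_cast hab
      refine ENNReal.ofReal_le_ofReal ?_
      gcongr
    have hrec : ∀ Y j, 1 ≤ j → j ≤ Y.card → Y.card < X.card →
        HasCost x (upToDepth s g d Y j) (IsSplit x Y j) (c Y.card) := by
      intro Y j hj hjY hYX
      refine (ih Y j hj hjY (by omega)).mono (ENNReal.ofReal_le_ofReal ?_)
      have : min (j : ℝ) (Y.card - j) ≤ Y.card / 2 := by
        rcases le_total (j : ℝ) (Y.card / 2) with h | h
        · exact (min_le_left _ _).trans h
        · exact (min_le_right _ _).trans (by linarith)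
      linarith
    rw [upToDepth]
    refine (body_hasCost_average hc hk1 hkX (by omega) hs1 hsX (hg _) hrec rfl).mono ?_
    rw [← hn]
    set t : ℝ := n * g n / s n with ht
    have ht0 : 0 ≤ t := by
      have := hg n
      positivity
    set δ : ℝ := Real.exp (-(g n ^ 2 / (4 * s n))) with hδ
    have hδ0 : 0 < δ := Real.exp_pos _
    have hfloor : c ⌊4 * t⌋₊ ≤ ENNReal.ofReal (6 * t + γ * (4 * t) ^ η) := by
      have h := Nat.floor_le (show 0 ≤ 4 * t by positivity)
      refine ENNReal.ofReal_le_ofReal ?_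
      have h' : (⌊4 * t⌋₊ : ℝ) ^ η ≤ (4 * t) ^ η := by gcongr
      nlinarith
    calc 2 * c (s n) + (n - s n : ℕ) +
          (ENNReal.ofReal (min (k : ℝ) (n - k) + 2 * t) + c ⌊4 * t⌋₊) +
          ENNReal.ofReal (4 * δ) * (n + c n)
        ≤ ENNReal.ofReal 2 * ENNReal.ofReal (3 / 2 * s n + γ * (s n : ℝ) ^ η) +
          ENNReal.ofReal (n - s n) +
          (ENNReal.ofReal (min (k : ℝ) (n - k) + 2 * t) +
            ENNReal.ofReal (6 * t + γ * (4 * t) ^ η)) +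
          ENNReal.ofReal (4 * δ) *
            (ENNReal.ofReal n + ENNReal.ofReal (3 / 2 * n + γ * (n : ℝ) ^ η)) := by
          rw [← ENNReal.ofReal_natCast (n - s n), Nat.cast_sub hsX.le, ENNReal.ofReal_natCast n,
            ENNReal.ofReal_ofNat]
          gcongr
      _ = ENNReal.ofReal (2 * (3 / 2 * s n + γ * (s n : ℝ) ^ η) + (n - s n) +
          ((min (k : ℝ) (n - k) + 2 * t) + (6 * t + γ * (4 * t) ^ η)) +
          4 * δ * (n + (3 / 2 * n + γ * (n : ℝ) ^ η))) := by
          have hsn : (0 : ℝ) ≤ n - s n := sub_nonneg.2 (by exact_mod_cast hsX.le)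
          rw [← ENNReal.ofReal_mul (by norm_num), ← ENNReal.ofReal_add (by positivity) hsn,
            ← ENNReal.ofReal_add (by positivity) (by positivity),
            ← ENNReal.ofReal_add (by positivity) (by positivity),
            ← ENNReal.ofReal_add (by positivity) (by positivity),
            ← ENNReal.ofReal_mul (by positivity),
            ← ENNReal.ofReal_add (by positivity) (by positivity)]
      _ ≤ _ := by
          refine ENNReal.ofReal_le_ofReal ?_
          have h1 := hlin n hnN
          have h2 := mul_le_mul_of_nonneg_left (hpow n hnN) hγ0
          have h3 : C * (n : ℝ) ^ η ≤ γ / 2 * (n : ℝ) ^ η := by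
            gcongr
            linarith
          rw [← hδ, ← ht] at h1 h2
          nlinarith

end Select

/-! ### Asymptotics of the sample size and the gap -/

open Filter in
theorem eventually_mul_rpow_le (C : ℝ) {a b : ℝ} (hab : a < b) :
    ∀ᶠ n : ℕ in atTop, C * (n : ℝ) ^ a ≤ (n : ℝ) ^ b := by
  have h := ((tendsto_rpow_atTop (sub_pos.2 hab)).comp
    tendsto_natCast_atTop_atTop).eventually_ge_atTop C
  filter_upwards [h, eventually_gt_atTop 0] with n hn hn0
  have hn0' : (0 : ℝ) < n := by exact_mod_cast hn0
  calc C * (n : ℝ) ^ a ≤ (n : ℝ) ^ (b - a) * (n : ℝ) ^ a := by gcongr; exact hn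
    _ = (n : ℝ) ^ b := by rw [← Real.rpow_add hn0', sub_add_cancel]

open Filter in
theorem eventually_exp_neg_mul_rpow_mul_le {b ε : ℝ} (hb : 0 < b) (hε : 0 < ε) :
    ∀ᶠ n : ℕ in atTop, Real.exp (-(b * (n : ℝ) ^ ε)) * n ≤ 1 := by
  have h1 := (isLittleO_exp_neg_mul_rpow_atTop hb (-(1 / ε))).comp_tendsto
    ((tendsto_rpow_atTop hε).comp tendsto_natCast_atTop_atTop)
  filter_upwards [h1.bound one_pos, eventually_gt_atTop 0] with n hn hn0
  have hn0' : (0 : ℝ) < n := by exact_mod_cast hn0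
  simp only [Function.comp_apply, one_mul] at hn
  rw [Real.norm_of_nonneg (Real.exp_pos _).le, Real.norm_of_nonneg (by positivity),
    ← Real.rpow_mul hn0'.le] at hn
  have h2 : ε * -(1 / ε) = -1 := by field_simp
  rw [h2, Real.rpow_neg_one, neg_mul] at hn
  calc _ ≤ (n : ℝ)⁻¹ * n := by gcongr
    _ = 1 := inv_mul_cancel₀ hn0'.ne'

theorem one_le_reischukSize {α : ℝ} (hα : 0 < α) (εs : ℝ) {n : ℕ} (hn : 2 ≤ n) :
    1 ≤ reischukSize α εs n ∧ reischukSize α εs n < n := by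
  have hn0 : (0 : ℝ) < n := by exact_mod_cast (by omega : 0 < n)
  have h1 : 1 ≤ ⌈α * (n : ℝ) ^ εs⌉₊ := Nat.one_le_ceil_iff.2 (by positivity)
  have h2 : reischukSize α εs n ≤ n - 1 := min_le_right _ _
  exact ⟨le_min h1 (by omega), by omega⟩

theorem reischukGap_sq {β : ℝ} (hβ : 0 < β) (α ε εs : ℝ) (n : ℕ) :
    reischukGap α β ε εs n ^ 2 = β * reischukSize α εs n * (n : ℝ) ^ ε :=
  Real.sq_sqrt (by positivity)

open Filter in
theorem eventually_reischukSize_bounds {α εs : ℝ} (hα : 0 < α) (h0 : 0 < εs) (h1 : εs < 1) :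
    ∀ᶠ n : ℕ in atTop, α * (n : ℝ) ^ εs ≤ reischukSize α εs n ∧
      (reischukSize α εs n : ℝ) ≤ (α + 1) * (n : ℝ) ^ εs := by
  filter_upwards [eventually_mul_rpow_le (α + 2) h1, eventually_ge_atTop 1] with n hn hn1
  have hn1' : (1 : ℝ) ≤ n := by exact_mod_cast hn1
  have hpow : 1 ≤ (n : ℝ) ^ εs := Real.one_le_rpow hn1' h0.le
  have hceil := (Nat.ceil_lt_add_one (show 0 ≤ α * (n : ℝ) ^ εs by positivity)).le
  rw [Real.rpow_one] at hn
  have hle : ⌈α * (n : ℝ) ^ εs⌉₊ ≤ n - 1 := by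
    refine Nat.ceil_le.2 ?_
    rw [Nat.cast_sub hn1]
    push_cast
    linarith
  rw [reischukSize, min_eq_left hle]
  exact ⟨Nat.le_ceil _, by linarith⟩

open Filter in
/-- For the sample size `s` and the gap `g` of the theorem, `s` and `n * g / s` are `O(n ^ η)`,
while the exponential bound on the failure probability decays faster than any power of `n`. -/
theorem eventually_reischuk_overhead_le {α β ε εs η : ℝ} (hα : 0 < α) (hβ : 0 < β) (hε : 0 < ε)
    (hεs : ε < εs) (hη : η = max (1 + (ε - εs) / 2) εs) (hη1 : η < 1) :
    ∃ C : ℝ, ∀ᶠ n : ℕ in atTop,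
      2 * (reischukSize α εs n : ℝ) +
        8 * (n * reischukGap α β ε εs n / reischukSize α εs n) +
        10 * (Real.exp (-(reischukGap α β ε εs n ^ 2 / (4 * reischukSize α εs n))) * n) ≤
          C * (n : ℝ) ^ η ∧
      2 * (reischukSize α εs n : ℝ) ^ η +
        (4 * (n * reischukGap α β ε εs n / reischukSize α εs n)) ^ η +
        4 * (Real.exp (-(reischukGap α β ε εs n ^ 2 / (4 * reischukSize α εs n))) *
          (n : ℝ) ^ η) ≤ (n : ℝ) ^ η / 2 := by
  have hεs0 : 0 < εs := hε.trans hεs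
  have hηs : εs ≤ η := hη ▸ le_max_right _ _
  have hηt : 1 + (ε - εs) / 2 ≤ η := hη ▸ le_max_left _ _
  have hη0 : 0 < η := hεs0.trans_le hηs
  have hηη : η * η < η := by nlinarith
  set q : ℝ := Real.sqrt (β / α) with hq
  refine ⟨2 * (α + 1) + 8 * q + 10, ?_⟩
  filter_upwards [eventually_reischukSize_bounds hα hεs0 (hηs.trans_lt hη1),
    eventually_exp_neg_mul_rpow_mul_le (show 0 < β / 4 by positivity) hε,
    eventually_mul_rpow_le (16 * (α + 1) ^ η) hηη,
    eventually_mul_rpow_le (8 * (4 * q) ^ η) hηη,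
    eventually_ge_atTop 32] with n hs hexp hpow1 hpow2 hn32
  obtain ⟨hs1, hs2⟩ := hs
  have hn32' : (32 : ℝ) ≤ n := by exact_mod_cast hn32
  have hn0 : (0 : ℝ) < n := by linarith
  have hn1 : (1 : ℝ) ≤ n := by linarith
  have hg2 := reischukGap_sq hβ α ε εs n
  have hg0 : 0 ≤ reischukGap α β ε εs n := Real.sqrt_nonneg _
  set s : ℝ := ((reischukSize α εs n : ℕ) : ℝ) with hs
  set g : ℝ := reischukGap α β ε εs n with hg
  have hs0 : 0 < s := lt_of_lt_of_le (by positivity) hs1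
  have hnη : 1 ≤ (n : ℝ) ^ η := Real.one_le_rpow hn1 hη0.le
  have hsη : s ≤ (α + 1) * (n : ℝ) ^ η := hs2.trans (by gcongr)
  have htη : n * g / s ≤ q * (n : ℝ) ^ η := by
    have hroot : n * g / s ≤ q * (n : ℝ) ^ (1 + (ε - εs) / 2) := by
      refine le_of_sq_le_sq ?_ (by positivity)
      have hq2 : q ^ 2 = β / α := Real.sq_sqrt (by positivity)
      have hexpo : ((n : ℝ) ^ (1 + (ε - εs) / 2)) ^ 2 = n ^ 2 * (n : ℝ) ^ ε / (n : ℝ) ^ εs := by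
        rw [← Real.rpow_natCast, ← Real.rpow_mul hn0.le, ← Real.rpow_natCast (n : ℝ) 2,
          ← Real.rpow_add hn0, ← Real.rpow_sub hn0]
        congr 1
        push_cast
        ring
      rw [mul_pow, hq2, hexpo, div_pow, mul_pow, hg2]
      have heq : (n : ℝ) ^ 2 * (β * s * (n : ℝ) ^ ε) / s ^ 2 =
          β * (n ^ 2 * (n : ℝ) ^ ε) / s := by
        field_simp
      have heq' : β / α * ((n : ℝ) ^ 2 * (n : ℝ) ^ ε / (n : ℝ) ^ εs) =
          β * (n ^ 2 * (n : ℝ) ^ ε) / (α * (n : ℝ) ^ εs) := by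
        field_simp
      rw [heq, heq']
      gcongr
    refine hroot.trans ?_
    gcongr
  have ht0 : 0 ≤ n * g / s := by positivity
  have hδeq : Real.exp (-(g ^ 2 / (4 * s))) = Real.exp (-(β / 4 * (n : ℝ) ^ ε)) := by
    rw [hg2]
    congr 2
    field_simp
  rw [hδeq]
  set δ : ℝ := Real.exp (-(β / 4 * (n : ℝ) ^ ε)) with hδ
  have hδ0 : 0 < δ := Real.exp_pos _
  constructor
  · nlinarith
  · have hδ32 : δ ≤ 1 / 32 := by
      rw [le_div_iff₀ (by norm_num)]
      nlinarith
    have h1 : s ^ η ≤ (α + 1) ^ η * (n : ℝ) ^ (η * η) := by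
      rw [Real.rpow_mul hn0.le, ← Real.mul_rpow (by positivity) (by positivity)]
      gcongr
    have h2 : (4 * (n * g / s)) ^ η ≤ (4 * q) ^ η * (n : ℝ) ^ (η * η) := by
      rw [Real.rpow_mul hn0.le, ← Real.mul_rpow (by positivity) (by positivity)]
      refine Real.rpow_le_rpow (by positivity) ?_ hη0.le
      linarith
    have h3 : δ * (n : ℝ) ^ η ≤ 1 / 32 * (n : ℝ) ^ η := by gcongr
    linarith

theorem theoremt (α β ε εs η : ℝ) (hα : 0 < α) (hβ : 0 < β) (hε : 0 < ε) (hεs : ε < εs)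
    (hη : η = max (1 + (ε - εs) / 2) εs) (hη1 : η < 1) :
    ∃ γ : ℝ, 0 < γ ∧
      ∀ (n k : ℕ), 1 ≤ k → k ≤ n →
        ∀ (κ : Type*) [LinearOrder κ] (x : Fin n → κ),
          Prog.expectedComparisons x
              (select (reischukSize α εs) (reischukGap α β ε εs) (Finset.univ : Finset (Fin n)) k)
            ≤ ENNReal.ofReal ((n : ℝ) + min (k : ℝ) ((n : ℝ) - k) + γ * (n : ℝ) ^ η) := by
  obtain ⟨C, hC⟩ := eventually_reischuk_overhead_le hα hβ hε hεs hη hη1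
  obtain ⟨N, hN⟩ := Filter.eventually_atTop.1 hC
  have hη0 : 0 < η := (hε.trans hεs).trans_le (hη ▸ le_max_right _ _)
  refine ⟨max (2 * C) (4 ^ (max N 2 + 1)), lt_max_of_lt_right (by positivity),
    fun n k hk1 hkn κ _ x => ?_⟩
  have h := (Select.upToDepth_hasCost (x := x) (s := reischukSize α εs)
    (g := reischukGap α β ε εs) (N := max N 2)
    (fun n hn => one_le_reischukSize hα εs hn) (fun n => Real.sqrt_nonneg _) hη0
    (le_max_right _ _) (fun n hn => (hN n ((le_max_left _ _).trans hn)).1)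
    (fun n hn => (hN n ((le_max_left _ _).trans hn)).2) (le_max_left _ _) (le_max_right _ _)
    n Finset.univ k hk1 (by simpa using hkn) (by simp)).expectedComparisons_le
  simpa [select] using h
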